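/- **Theorem.** Let $m\ge 1$ be an integer and let $d$ be the Carnot–Carathéodory distance on $\mathbb R^3=\mathbb C\times\mathbb R\ni(z,t)$, $z=x+iy$, of the vector fields $X=\partial_x+|z|^{2m}y\,\partial_t$ and $Y=\partial_y-|z|^{2m}x\,\partial_t$. That is, $d(p,q)$ is the infimum of $\int_0^1|(\alpha(s),\beta(s))|\,ds$ over all absolutely continuous curves $\gamma:[0,1]\to\mathbb R^3$ with $\gamma(0)=p$, $\gamma(1)=q$ and $\dot\gamma=\alpha X(\gamma)+\beta Y(\gamma)$ a.e. on $[0,1]$. Below, balls $B(p,r)=\{q: d(p,q)<r\}$ and diameters are taken with respect to $d$. Let $\Omega\subset\mathbb R^3$ be a bounded domain (nonempty, open, connected) with $C^\infty$ boundary: every $p\in\partial\Omega$ has an open neighborhood $U$ and a function $F\in C^\infty(U)$ with $dF\ne0$ on $U$, $\Omega\cap U=\{F<0\}$ and $\partial\Omega\cap U=\{F=0\}$. Call $p\in\partial\Omega$ *characteristic* if $X(p)$ and $Y(p)$ are both tangent to $\partial\Omega$ at $p$. Assume that $\Omega$ is *$m$-admissible*: every characteristic point $p\in\partial\Omega$ has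 a neighborhood $U_p$ in $\mathbb R^3$ such that $\partial\Omega\cap U_p=\{(z,\phi(z)):z\in A\}$ for some open set $A\subset\mathbb R^2$ and some $\phi\in C^\infty(A)$ for which there is a constant $C>0$ with $$|D^3\phi(z)|\le C|z|^{2m-1},\qquad |D^2\phi(z)|\le C|z|^{2m},\qquad |D\phi(z)|\le C|z|^{2m+1}\qquad\text{for all } z\in A,$$ where $|D^k\phi(z)|$ is the largest absolute value of a $k$-th order partial derivative of $\phi$ at $z$. Then: 1. $\Omega$ is a uniform (or $(\varepsilon,\delta)$) domain in $(\mathbb R^3,d)$: there are $\varepsilon,\delta>0$ such that for all $p,q\in\Omega$ there is a continuous curve $\gamma:[0,1]\to\Omega$ with $\gamma(0)=p$, $\gamma(1)=q$, $\operatorname{diam}(\gamma)\le\delta^{-1}d(p,q)$ and, for all $t\in[0,1]$, $$B\big(\gamma(t),\,\varepsilon\min\{\operatorname{diam}(\gamma|_{[0,t]}),\operatorname{diam}(\gamma|_{[t,1]})\}\big)\subset\Omega .$$ 2. In particular, $\Omega$ is a John domain in $(\mathbb R^3,d)$: there are $\lambda>0$ and $p_0\in\Omega$ such that for all $p\in\Omega$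 there is a continuous curve $\gamma:[0,1]\to\Omega$ with $\gamma(0)=p$, $\gamma(1)=p_0$ and $B\big(\gamma(t),\lambda\operatorname{diam}(\gamma|_{[0,t]})\big)\subset\Omega$ for all $t\in(0,1)$. -/

import Mathlib

open Set Filter Topology MeasureTheory
open scoped ContDiff

namespace Siegel

noncomputable section

/-! Points of `ℝ³ = ℂ × ℝ` are written `p = (z, t)`, with `z = x + iy`. -/

/-- The vector field `X = ∂_x + |z|^{2m} y ∂_t`. -/
def X (m : ℕ) (p : ℂ × ℝ) : ℂ × ℝ := (1, ‖p.1‖ ^ (2 * m) * p.1.im)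

/-- The vector field `Y = ∂_y - |z|^{2m} x ∂_t`. -/
def Y (m : ℕ) (p : ℂ × ℝ) : ℂ × ℝ := (Complex.I, -(‖p.1‖ ^ (2 * m) * p.1.re))

/-- The absolutely continuous curve `γ : [0,1] → ℝ³` is horizontal, with
`γ' = α X(γ) + β Y(γ)` almost everywhere on `[0,1]`. -/
structure IsHorizontal (m : ℕ) (γ : ℝ → ℂ × ℝ) (α β : ℝ → ℝ) : Prop where
  absolutelyContinuous : AbsolutelyContinuousOnInterval γ 0 1
  hasDerivAt : ∀ᵐ s ∂(volume.restrict (Icc (0 : ℝ) 1)),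
    HasDerivAt γ (α s • X m (γ s) + β s • Y m (γ s)) s

/-- The length `∫₀¹ |(α, β)| ds` of a horizontal curve with coefficients `α`, `β`. -/
def horizontalLength (α β : ℝ → ℝ) : ENNReal :=
  ∫⁻ s in Icc (0 : ℝ) 1, ENNReal.ofReal (Real.sqrt (α s ^ 2 + β s ^ 2))

/-- The Carnot–Carathéodory distance: the infimum of the lengths of the horizontal curves
that join `p` to `q`. -/
def ccDist (m : ℕ) (p q : ℂ × ℝ) : ENNReal :=
  sInf {L | ∃ (γ : ℝ → ℂ × ℝ) (α β : ℝ → ℝ),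
    IsHorizontal m γ α β ∧ γ 0 = p ∧ γ 1 = q ∧ horizontalLength α β = L}

/-- The open ball `B(p, r)` of the Carnot–Carathéodory distance. -/
def ccBall (m : ℕ) (p : ℂ × ℝ) (r : ENNReal) : Set (ℂ × ℝ) := {q | ccDist m p q < r}

/-- The diameter, for the Carnot–Carathéodory distance, of `γ` restricted to `[a,b]`. -/
def curveDiam (m : ℕ) (γ : ℝ → ℂ × ℝ) (a b : ℝ) : ENNReal :=
  ⨆ s ∈ Icc a b, ⨆ s' ∈ Icc a b, ccDist m (γ s) (γ s')

/-- `γ` is a continuous curve `[0,1] → Ω` from `p` to `q`. -/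
structure IsCurveIn (Ω : Set (ℂ × ℝ)) (γ : ℝ → ℂ × ℝ) (p q : ℂ × ℝ) : Prop where
  continuousOn : ContinuousOn γ (Icc 0 1)
  mapsTo : MapsTo γ (Icc 0 1) Ω
  source : γ 0 = p
  target : γ 1 = q

/-- Uniform domains, also called `(ε, δ)`-domains, of `(ℝ³, d)`. -/
def IsUniformDomain (m : ℕ) (Ω : Set (ℂ × ℝ)) : Prop :=
  IsOpen Ω ∧ ∃ ε δ : ℝ, 0 < ε ∧ 0 < δ ∧ ∀ p ∈ Ω, ∀ q ∈ Ω, ∃ γ : ℝ → ℂ × ℝ,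
    IsCurveIn Ω γ p q ∧
    curveDiam m γ 0 1 ≤ ENNReal.ofReal δ⁻¹ * ccDist m p q ∧
    ∀ t ∈ Icc (0 : ℝ) 1,
      ccBall m (γ t) (ENNReal.ofReal ε * min (curveDiam m γ 0 t) (curveDiam m γ t 1)) ⊆ Ω

/-- John domains of `(ℝ³, d)`. -/
def IsJohnDomain (m : ℕ) (Ω : Set (ℂ × ℝ)) : Prop :=
  IsOpen Ω ∧ Bornology.IsBounded Ω ∧ ∃ l : ℝ, 0 < l ∧ ∃ p₀ ∈ Ω, ∀ p ∈ Ω, ∃ γ : ℝ → ℂ × ℝ,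
    IsCurveIn Ω γ p p₀ ∧
    ∀ t ∈ Ioo (0 : ℝ) 1, ccBall m (γ t) (ENNReal.ofReal l * curveDiam m γ 0 t) ⊆ Ω

/-- `F` is a smooth local defining function of `Ω` near the point `p`: on a neighborhood `U`
of `p`, it is smooth without critical points, `Ω = {F < 0}` and `∂Ω = {F = 0}`. -/
def IsDefiningFunction (Ω : Set (ℂ × ℝ)) (p : ℂ × ℝ) (F : ℂ × ℝ → ℝ) : Prop :=
  ∃ U : Set (ℂ × ℝ), IsOpen U ∧ p ∈ U ∧ ContDiffOn ℝ ∞ F U ∧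
    (∀ q ∈ U, fderiv ℝ F q ≠ 0) ∧
    Ω ∩ U = {q | q ∈ U ∧ F q < 0} ∧ frontier Ω ∩ U = {q | q ∈ U ∧ F q = 0}

/-- The open set `Ω` has `C^∞` boundary. -/
def HasSmoothBoundary (Ω : Set (ℂ × ℝ)) : Prop :=
  ∀ p ∈ frontier Ω, ∃ F : ℂ × ℝ → ℝ, IsDefiningFunction Ω p F

/-- `p` is a characteristic point of `∂Ω`: both `X` and `Y` are tangent to `∂Ω` at `p`, the
tangent space being the kernel of the differential of a local defining function. -/
def IsCharacteristic (m : ℕ) (Ω : Set (ℂ × ℝ)) (p : ℂ × ℝ) : Prop :=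
  p ∈ frontier Ω ∧ ∃ F : ℂ × ℝ → ℝ, IsDefiningFunction Ω p F ∧
    fderiv ℝ F p (X m p) = 0 ∧ fderiv ℝ F p (Y m p) = 0

/-- `|D^k φ(z)|`: the largest absolute value of a partial derivative of `φ` of order `k`,
with respect to `x` (direction `1`) and `y` (direction `i`). -/
def derivMax (k : ℕ) (φ : ℂ → ℝ) (z : ℂ) : ℝ :=
  ⨆ j : Fin k → Fin 2, |iteratedFDeriv ℝ k φ z (fun i => ![(1 : ℂ), Complex.I] (j i))|

/-- `S` is an `m`-admissible graph (for `m ≥ 1`, so that `2 * m - 1` is the true difference). -/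
def IsAdmissibleGraph (m : ℕ) (S : Set (ℂ × ℝ)) : Prop :=
  ∃ (A : Set ℂ) (φ : ℂ → ℝ), IsOpen A ∧ ContDiffOn ℝ ∞ φ A ∧
    S = {p | p.1 ∈ A ∧ p.2 = φ p.1} ∧
    ∃ C : ℝ, 0 < C ∧ ∀ z ∈ A,
      derivMax 3 φ z ≤ C * ‖z‖ ^ (2 * m - 1) ∧
      derivMax 2 φ z ≤ C * ‖z‖ ^ (2 * m) ∧
      derivMax 1 φ z ≤ C * ‖z‖ ^ (2 * m + 1)

/-- `Ω` is a bounded `m`-admissible domain (nonempty, open and connected) of `ℝ³`. -/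
structure IsAdmissibleDomain (m : ℕ) (Ω : Set (ℂ × ℝ)) : Prop where
  isOpen : IsOpen Ω
  isConnected : IsConnected Ω
  isBounded : Bornology.IsBounded Ω
  smoothBoundary : HasSmoothBoundary Ω
  admissible : ∀ p, IsCharacteristic m Ω p →
    ∃ U ∈ 𝓝 p, IsAdmissibleGraph m (frontier Ω ∩ U)

end

end Siegel

/-!
The idea is to replace the Carnot–Carathéodory distance `d` by explicit boxes, and then to argue
with affine functions in the coordinates of the frame `X`, `Y`, `∂_t`.

*Balls and boxes.* In the coordinates `p + w.re X(p) + w.im Y(p) + c ∂_t` based at `p = (z, t)`,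
the ball of radius `r` is comparable with the box `|w| ≤ r`, `|c| ≤ Λ(z, r) = r² (|z| + r)^{2m}`.
One inclusion (`inBox_of_ccDist_lt`) integrates the height of a horizontal curve; the other one
(`ccDist_le_of_inBox`) joins the points by a lifted segment followed by radial motions and
rotations, which enclose the area needed to correct the height.

*Local models.* Near each point of the closure, `Ω` is `{F < 0}`, where
`F(p + w.re X + w.im Y + c ∂_t)` is `F(p) + ⟨G(p), w⟩ + σ c` up to an error that is small when
compared with `s |G(p)| + σ² M Λ(z, s)` at each small scale `s` (`LocalModel`). At a characteristic
point `F = ± (t - φ(z))`, so that `σ = ± 1` and the bound `|D²φ(z)| ≤ C |z|^{2m}` gives an error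
`O(Λ(z, s))`, which is beaten by a large `M`. At a noncharacteristic point `σ = 0`, and `|G|` is
bounded below while the error is `O(s²)`. Inside `Ω` a constant `F` does.

*Local construction.* From `p ∈ Ω` follow the curve `s ↦ p - s (G/|G|)(p) - σ M Λ(z, s) ∂_t`, written
in the frame at `p`: `F` decreases along it so fast that a box of radius comparable with `s`
remains in `Ω` (`LocalModel.johnArc_descent`). If `q` is at distance `r` from `p`, then at scale
a large multiple of `r` the affine part based at `p` is also very negative at the corresponding
point for `q` (`LocalModel.exists_descent_eq`), hence along the segment between the two points. This
yields a uniform arc between close points (`LocalModel.uniformArc_of_inBox`).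

*Globalization.* By compactness of the closure and connectedness, all points of `Ω` are joined to a
fixed one by John arcs (`IsAdmissibleDomain.exists_johnArc`). Two points at distance bounded below are
joined through that point, and close points by the local construction
(`IsAdmissibleDomain.exists_uniformArc`).
-/

namespace Siegel

/-! ### Coordinates adapted to the fields, and boxes -/

/-- The vertical speed `lin m z w` of a horizontal curve that passes through a point over `z` with
planar velocity `w`: if `w = α + iβ`, the velocity `α X + β Y` is `(w, lin m z w)`. -/
noncomputable def lin (m : ℕ) (z : ℂ) : ℂ →L[ℝ] ℝ :=
  (‖z‖ ^ (2 * m)) • (z.im • Complex.reCLM - z.re • Complex.imCLM)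

lemma lin_apply (m : ℕ) (z w : ℂ) :
    lin m z w = ‖z‖ ^ (2 * m) * (z.im * w.re - z.re * w.im) := by
  simp [lin]

/-- The point with coordinates `(w, c)` in the frame `X`, `Y`, `∂_t` based at `p`, that is
`p + w.re X(p) + w.im Y(p) + c ∂_t`. -/
noncomputable def pt (m : ℕ) (p : ℂ × ℝ) (w : ℂ) (c : ℝ) : ℂ × ℝ :=
  (p.1 + w, p.2 + lin m p.1 w + c)

/-- The vertical size `r² (|z| + r)^{2m}` of a ball of radius `r` centred over `z`. -/
noncomputable def vsize (m : ℕ) (z : ℂ) (r : ℝ) : ℝ := r ^ 2 * (‖z‖ + r) ^ (2 * m)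

/-- The point `q` lies in the box of radius `r` centred at `p`. Boxes are comparable with
Carnot–Carathéodory balls, see `inBox_of_ccDist_lt` and `ccDist_le_of_inBox`. -/
def InBox (m : ℕ) (r : ℝ) (p q : ℂ × ℝ) : Prop :=
  ‖q.1 - p.1‖ ≤ r ∧ |q.2 - p.2 - lin m p.1 (q.1 - p.1)| ≤ vsize m p.1 r

lemma abs_pow_sub_pow_mul_le {a b ρ : ℝ} (ha : 0 ≤ a) (hb : 0 ≤ b) (haρ : a ≤ ρ) (hbρ : b ≤ ρ)
    (n : ℕ) : |a ^ n - b ^ n| * ρ ≤ n * ρ ^ n * |a - b| := by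
  have hρ : 0 ≤ ρ := ha.trans haρ
  induction n with
  | zero => simp
  | succ n ih =>
    have e : a ^ (n + 1) - b ^ (n + 1) = a ^ n * (a - b) + (a ^ n - b ^ n) * b := by ring
    have h1 : |a ^ (n + 1) - b ^ (n + 1)| ≤ ρ ^ n * |a - b| + |a ^ n - b ^ n| * ρ := by
      rw [e]
      refine (abs_add_le _ _).trans ?_
      rw [abs_mul, abs_mul, abs_of_nonneg (pow_nonneg ha n), abs_of_nonneg hb]
      gcongr
    calc _ ≤ (ρ ^ n * |a - b| + |a ^ n - b ^ n| * ρ) * ρ := by gcongr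
      _ ≤ (ρ ^ n * |a - b| + n * ρ ^ n * |a - b|) * ρ := by gcongr
      _ = _ := by push_cast; ring

lemma norm_pow_smul_sub_le {z z' : ℂ} {ρ : ℝ} (hz : ‖z‖ ≤ ρ) (hz' : ‖z'‖ ≤ ρ) (n : ℕ) :
    ‖((‖z'‖ ^ n : ℝ) : ℂ) * z' - ((‖z‖ ^ n : ℝ) : ℂ) * z‖ ≤ (n + 1) * ρ ^ n * ‖z' - z‖ := by
  have e : ((‖z'‖ ^ n : ℝ) : ℂ) * z' - ((‖z‖ ^ n : ℝ) : ℂ) * z =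
      ((‖z'‖ ^ n : ℝ) : ℂ) * (z' - z) + ((‖z'‖ ^ n - ‖z‖ ^ n : ℝ) : ℂ) * z := by
    push_cast; ring
  rw [e]
  refine (norm_add_le _ _).trans ?_
  rw [norm_mul, norm_mul, Complex.norm_real, Complex.norm_real, Real.norm_eq_abs, Real.norm_eq_abs,
    abs_of_nonneg (by positivity)]
  have h1 := abs_pow_sub_pow_mul_le (norm_nonneg z') (norm_nonneg z) hz' hz n
  have h2 : |‖z'‖ - ‖z‖| ≤ ‖z' - z‖ := abs_norm_sub_norm_le _ _
  have hρ : 0 ≤ ρ := (norm_nonneg z).trans hz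
  calc _ ≤ ρ ^ n * ‖z' - z‖ + |‖z'‖ ^ n - ‖z‖ ^ n| * ρ := by gcongr
    _ ≤ ρ ^ n * ‖z' - z‖ + n * ρ ^ n * |‖z'‖ - ‖z‖| := by gcongr
    _ ≤ ρ ^ n * ‖z' - z‖ + n * ρ ^ n * ‖z' - z‖ := by gcongr
    _ = _ := by ring

lemma abs_lin_sub_lin_le {m : ℕ} {z z' : ℂ} {ρ : ℝ} (hz : ‖z‖ ≤ ρ) (hz' : ‖z'‖ ≤ ρ) (w : ℂ) :
    |lin m z' w - lin m z w| ≤ (2 * m + 1) * ρ ^ (2 * m) * ‖z' - z‖ * ‖w‖ := by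
  set u : ℂ := ((‖z'‖ ^ (2 * m) : ℝ) : ℂ) * z' - ((‖z‖ ^ (2 * m) : ℝ) : ℂ) * z with hu
  have e : lin m z' w - lin m z w = (u * (starRingEnd ℂ) w).im := by
    rw [hu, lin_apply, lin_apply]
    simp only [Complex.mul_im, Complex.sub_im, Complex.sub_re, Complex.mul_re,
      Complex.ofReal_re, Complex.ofReal_im, Complex.conj_re, Complex.conj_im]
    ring
  rw [e]
  have h := norm_pow_smul_sub_le hz hz' (2 * m)
  calc _ ≤ ‖u * (starRingEnd ℂ) w‖ := Complex.abs_im_le_norm _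
    _ = ‖u‖ * ‖w‖ := by rw [norm_mul, RCLike.norm_conj]
    _ ≤ _ := by
      gcongr
      exact_mod_cast h

lemma vsize_nonneg (m : ℕ) (z : ℂ) (r : ℝ) : 0 ≤ vsize m z r := by
  unfold vsize
  exact mul_nonneg (sq_nonneg r) (by rw [pow_mul]; positivity)

lemma vsize_mono (m : ℕ) (z : ℂ) {r s : ℝ} (hr : 0 ≤ r) (hrs : r ≤ s) :
    vsize m z r ≤ vsize m z s := by
  unfold vsize; gcongr

lemma vsize_zero (m : ℕ) (z : ℂ) : vsize m z 0 = 0 := by simp [vsize]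

lemma sq_mul_vsize_le (m : ℕ) (z : ℂ) {r k : ℝ} (hr : 0 ≤ r) (hk : 1 ≤ k) :
    k ^ 2 * vsize m z r ≤ vsize m z (k * r) := by
  unfold vsize
  have : r ≤ k * r := le_mul_of_one_le_left hr hk
  calc _ = (k * r) ^ 2 * (‖z‖ + r) ^ (2 * m) := by ring
    _ ≤ _ := by gcongr

lemma mul_vsize_le (m : ℕ) (z : ℂ) {r k : ℝ} (hr : 0 ≤ r) (hk : 1 ≤ k) :
    k * vsize m z r ≤ vsize m z (k * r) := by
  refine le_trans ?_ (sq_mul_vsize_le m z hr hk)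
  have := vsize_nonneg m z r
  gcongr
  nlinarith

lemma vsize_mul_le (m : ℕ) (z : ℂ) {r k : ℝ} (hr : 0 ≤ r) (hk : 0 ≤ k) (hk1 : k ≤ 1) :
    vsize m z (k * r) ≤ k * vsize m z r := by
  unfold vsize
  have : k * r ≤ r := mul_le_of_le_one_left hr hk1
  calc _ ≤ (k * r) ^ 2 * (‖z‖ + r) ^ (2 * m) := by gcongr
    _ = k * (k * (r ^ 2 * (‖z‖ + r) ^ (2 * m))) := by ring
    _ ≤ k * (1 * (r ^ 2 * (‖z‖ + r) ^ (2 * m))) := by gcongr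
    _ = _ := by ring

lemma InBox.mono {m : ℕ} {r s : ℝ} {p q : ℂ × ℝ} (h : InBox m r p q) (hr : 0 ≤ r) (hrs : r ≤ s) :
    InBox m s p q :=
  ⟨h.1.trans hrs, h.2.trans (vsize_mono m _ hr hrs)⟩

lemma inBox_self (m : ℕ) (p : ℂ × ℝ) {r : ℝ} (hr : 0 ≤ r) : InBox m r p p := by
  refine ⟨by simpa using hr, ?_⟩
  rw [sub_self, sub_self, map_zero, sub_zero, abs_zero]
  exact vsize_nonneg m _ r

/-- Every point has coordinates in the frame based at `p`. -/
lemma pt_coords (m : ℕ) (p q : ℂ × ℝ) :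
    pt m p (q.1 - p.1) (q.2 - p.2 - lin m p.1 (q.1 - p.1)) = q := by
  ext1 <;> simp [pt]

lemma pt_zero (m : ℕ) (p : ℂ × ℝ) : pt m p 0 0 = p := by
  ext1 <;> simp [pt]

lemma inBox_pt {m : ℕ} {p : ℂ × ℝ} {w : ℂ} {c r : ℝ} :
    InBox m r p (pt m p w c) ↔ ‖w‖ ≤ r ∧ |c| ≤ vsize m p.1 r := by
  have : p.2 + lin m p.1 w + c - p.2 - lin m p.1 w = c := by ring
  simp only [InBox, pt, add_sub_cancel_left, this]

lemma pt_pt (m : ℕ) (p : ℂ × ℝ) (w w' : ℂ) (c c' : ℝ) :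
    pt m (pt m p w c) w' c' =
      pt m p (w + w') (c + (c' + (lin m (p.1 + w) w' - lin m p.1 w'))) := by
  ext1
  · simp [pt, add_assoc]
  · simp only [pt, map_add]; ring

/-- Points with comparable coordinates at a common base point are in comparable position with
respect to each other. -/
lemma inBox_pt_pt {m : ℕ} {p : ℂ × ℝ} {w w' : ℂ} {c c' R B : ℝ} (hB : 0 ≤ B)
    (hw : ‖w‖ ≤ R) (hw' : ‖w'‖ ≤ R) (hc : |c| ≤ B * vsize m p.1 R)
    (hc' : |c'| ≤ B * vsize m p.1 R) :
    InBox m ((2 * B + 4 * m + 2) * (2 * R)) (pt m p w c) (pt m p w' c') := by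
  have hR : 0 ≤ R := (norm_nonneg w).trans hw
  have e : pt m p w' c' = pt m (pt m p w c) (w' - w)
      (c' - c - (lin m (p.1 + w) (w' - w) - lin m p.1 (w' - w))) := by
    rw [pt_pt]; congr 1 <;> ring
  have hww : ‖w' - w‖ ≤ 2 * R := (norm_sub_le _ _).trans (by linarith)
  have hk : (1 : ℝ) ≤ 2 * B + 4 * m + 2 := by
    have : (0 : ℝ) ≤ m := Nat.cast_nonneg m
    linarith
  rw [e, inBox_pt]
  refine ⟨hww.trans (le_mul_of_one_le_left (by positivity) hk), ?_⟩
  have h1 : |lin m (p.1 + w) (w' - w) - lin m p.1 (w' - w)| ≤ (4 * m + 2) * vsize m p.1 R := by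
    refine (abs_lin_sub_lin_le (ρ := ‖p.1‖ + R) (by linarith)
      ((norm_add_le _ _).trans (by linarith)) _).trans ?_
    rw [add_sub_cancel_left]
    calc _ ≤ (2 * m + 1) * (‖p.1‖ + R) ^ (2 * m) * R * (2 * R) := by gcongr
      _ = _ := by unfold vsize; ring
  have h2 : vsize m p.1 R ≤ vsize m (p.1 + w) (2 * R) := by
    unfold vsize
    have : ‖p.1‖ ≤ ‖p.1 + w‖ + ‖w‖ := by simpa using norm_sub_le (p.1 + w) w
    have h3 : R ≤ 2 * R := by linarith
    have h4 : ‖p.1‖ + R ≤ ‖p.1 + w‖ + 2 * R := by linarith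
    gcongr
  calc _ ≤ |c'| + |c| + |lin m (p.1 + w) (w' - w) - lin m p.1 (w' - w)| := by
        refine (abs_sub _ _).trans ?_
        gcongr
        exact abs_sub _ _
    _ ≤ (2 * B + 4 * m + 2) * vsize m p.1 R := by linarith
    _ ≤ (2 * B + 4 * m + 2) * vsize m (p.1 + w) (2 * R) := by gcongr
    _ ≤ _ := mul_vsize_le m _ (by positivity) hk

lemma InBox.trans_common {m : ℕ} {p x y : ℂ × ℝ} {R : ℝ} (hx : InBox m R p x)
    (hy : InBox m R p y) : InBox m ((4 * m + 4) * (2 * R)) x y := by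
  have := inBox_pt_pt (m := m) (p := p) (B := 1) zero_le_one hx.1 hy.1 (by rw [one_mul]; exact hx.2)
    (by rw [one_mul]; exact hy.2)
  rw [pt_coords, pt_coords] at this
  convert this using 2; ring

/-! ### The Carnot–Carathéodory distance -/

lemma absolutelyContinuousOnInterval_comp_of_monotone {E : Type*} [PseudoMetricSpace E]
    {f : ℝ → E} {φ : ℝ → ℝ} {a b c d : ℝ} {K : NNReal} (hf : AbsolutelyContinuousOnInterval f c d)
    (hφ : Monotone φ) (hK : LipschitzWith K φ) (hmaps : MapsTo φ (uIcc a b) (uIcc c d)) :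
    AbsolutelyContinuousOnInterval (f ∘ φ) a b := by
  rw [absolutelyContinuousOnInterval_iff] at hf ⊢
  intro ε hε
  obtain ⟨δ, hδ, H⟩ := hf ε hε
  refine ⟨δ / (K + 1), by positivity, fun E hE hlen => ?_⟩
  refine H (E.1, fun i => (φ (E.2 i).1, φ (E.2 i).2)) ⟨fun i hi => ?_, fun i hi j hj hij => ?_⟩ ?_
  · exact ⟨hmaps (hE.1 i hi).1, hmaps (hE.1 i hi).2⟩
  · have h := Set.disjoint_left.1 (hE.2 hi hj hij)
    refine Set.disjoint_left.2 fun y hy hy' => ?_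
    simp only [uIoc, mem_Ioc, ← hφ.map_min, ← hφ.map_max] at hy hy'
    -- Both intervals are nondegenerate, and the smaller of their right ends lies in both.
    have h1 := hφ.reflect_lt (hy.1.trans_le hy.2)
    have h2 := hφ.reflect_lt (hy'.1.trans_le hy'.2)
    have h3 := hφ.reflect_lt (hy.1.trans_le hy'.2)
    have h4 := hφ.reflect_lt (hy'.1.trans_le hy.2)
    refine h (a := min (max (E.2 i).1 (E.2 i).2) (max (E.2 j).1 (E.2 j).2)) ?_ ?_
    · exact ⟨lt_min h1 h3, min_le_left _ _⟩
    · exact ⟨lt_min h4 h2, min_le_right _ _⟩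
  · have hK1 : (0 : ℝ) < K + 1 := by positivity
    rw [lt_div_iff₀ hK1] at hlen
    refine lt_of_le_of_lt ?_ hlen
    rw [Finset.sum_mul]
    refine Finset.sum_le_sum fun i _ => (hK.dist_le_mul _ _).trans ?_
    have := dist_nonneg (x := (E.2 i).1) (y := (E.2 i).2)
    nlinarith

lemma absolutelyContinuousOnInterval_clm_comp {E : Type*} [NormedAddCommGroup E]
    [NormedSpace ℝ E] {f : ℝ → E} {a b : ℝ} (hf : AbsolutelyContinuousOnInterval f a b)
    (ℓ : E →L[ℝ] ℝ) : AbsolutelyContinuousOnInterval (fun s => ℓ (f s)) a b := by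
  have h : Tendsto (fun E : ℕ × (ℕ → ℝ × ℝ) =>
      ‖ℓ‖ * ∑ i ∈ Finset.range E.1, dist (f (E.2 i).1) (f (E.2 i).2)) _ _ :=
    Tendsto.const_mul ‖ℓ‖ hf
  rw [mul_zero] at h
  refine squeeze_zero (fun E => Finset.sum_nonneg fun i _ => dist_nonneg) (fun E => ?_) h
  rw [Finset.mul_sum]
  refine Finset.sum_le_sum fun i _ => ?_
  rw [dist_eq_norm, dist_eq_norm, ← map_sub]
  exact ℓ.le_opNorm _

/-- The fundamental theorem of calculus as an estimate: an absolutely continuous function whose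
derivative is bounded by `B h` has increments bounded by `B ∫ h`. -/
lemma ofReal_abs_sub_le_lintegral {f g h : ℝ → ℝ} {B t : ℝ}
    (hf : AbsolutelyContinuousOnInterval f 0 1) (ht : t ∈ Icc (0 : ℝ) 1) (hB : 0 ≤ B)
    (hg : ∀ᵐ s ∂(volume.restrict (Icc (0 : ℝ) 1)), HasDerivAt f (g s) s ∧ |g s| ≤ B * h s) :
    ENNReal.ofReal |f t - f 0| ≤
      ENNReal.ofReal B * ∫⁻ s in Icc (0 : ℝ) 1, ENNReal.ofReal (h s) := by
  have hf' : AbsolutelyContinuousOnInterval f 0 t := hf.mono (by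
    rw [uIcc_of_le ht.1, uIcc_of_le zero_le_one]; exact Icc_subset_Icc_right ht.2)
  rw [← hf'.integral_deriv_eq_sub, intervalIntegral.integral_of_le ht.1, ← Real.norm_eq_abs,
    ofReal_norm]
  refine (enorm_integral_le_lintegral_enorm _).trans ?_
  have hsub : Ioc (0 : ℝ) t ⊆ Icc 0 1 := fun s hs => ⟨hs.1.le, hs.2.trans ht.2⟩
  refine (lintegral_mono_set hsub).trans ?_
  rw [← lintegral_const_mul' _ _ ENNReal.ofReal_ne_top]
  refine lintegral_mono_ae ?_
  filter_upwards [hg] with s hs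
  rw [hs.1.deriv, ← ofReal_norm, Real.norm_eq_abs, ← ENNReal.ofReal_mul hB]
  exact ENNReal.ofReal_le_ofReal hs.2

lemma smul_X_add_smul_Y (m : ℕ) (p : ℂ × ℝ) (a b : ℝ) :
    a • X m p + b • Y m p = (⟨a, b⟩, lin m p.1 ⟨a, b⟩) := by
  ext1
  · apply Complex.ext <;> simp [X, Y]
  · simp only [X, Y, Prod.snd_add, Prod.smul_snd, smul_eq_mul, lin_apply]; ring

/-- A horizontal curve of length less than `r` does not leave, in the plane, the disk of radius
`r`. -/
lemma IsHorizontal.norm_fst_sub_le {m : ℕ} {γ : ℝ → ℂ × ℝ} {α β : ℝ → ℝ} {r t : ℝ}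
    (h : IsHorizontal m γ α β) (hr : 0 ≤ r) (hL : horizontalLength α β ≤ ENNReal.ofReal r)
    (ht : t ∈ Icc (0 : ℝ) 1) : ‖(γ t).1 - (γ 0).1‖ ≤ r := by
  set v : ℂ := (γ t).1 - (γ 0).1 with hv
  let ℓ : ℂ × ℝ →L[ℝ] ℝ := (v.re • Complex.reCLM + v.im • Complex.imCLM).comp
    (ContinuousLinearMap.fst ℝ ℂ ℝ)
  have key := ofReal_abs_sub_le_lintegral (f := fun s => ℓ (γ s))
    (g := fun s => ℓ (α s • X m (γ s) + β s • Y m (γ s)))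
    (h := fun s => Real.sqrt (α s ^ 2 + β s ^ 2)) (B := ‖v‖)
    (absolutelyContinuousOnInterval_clm_comp h.absolutelyContinuous ℓ) ht (norm_nonneg v) (by
      filter_upwards [h.hasDerivAt] with s hs
      refine ⟨ℓ.hasFDerivAt.comp_hasDerivAt s hs, ?_⟩
      rw [smul_X_add_smul_Y]
      have e : ℓ (⟨α s, β s⟩, lin m (γ s).1 ⟨α s, β s⟩) = v.re * α s + v.im * β s := by simp [ℓ]
      rw [e, Complex.norm_eq_sqrt_sq_add_sq v, ← Real.sqrt_mul (by positivity)]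
      refine Real.abs_le_sqrt ?_
      nlinarith [sq_nonneg (v.re * β s - v.im * α s)])
  have e : ℓ (γ t) - ℓ (γ 0) = ‖v‖ ^ 2 := by
    rw [← map_sub, ← Complex.normSq_eq_norm_sq, Complex.normSq_apply]
    simp [ℓ, ← hv]
  simp only [e] at key
  have key2 : ENNReal.ofReal |‖v‖ ^ 2| ≤ ENNReal.ofReal (‖v‖ * r) := by
    rw [ENNReal.ofReal_mul (norm_nonneg v)]
    exact key.trans (by gcongr; exact hL)
  rw [ENNReal.ofReal_le_ofReal_iff (by positivity), abs_of_nonneg (by positivity)] at key2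
  nlinarith [norm_nonneg v]

lemma exists_isHorizontal_of_ccDist_lt {m : ℕ} {p q : ℂ × ℝ} {L : ENNReal}
    (h : ccDist m p q < L) : ∃ (γ : ℝ → ℂ × ℝ) (α β : ℝ → ℝ),
      IsHorizontal m γ α β ∧ γ 0 = p ∧ γ 1 = q ∧ horizontalLength α β < L := by
  obtain ⟨L', ⟨γ, α, β, h1, h2, h3, h4⟩, hL⟩ := sInf_lt_iff.1 h
  exact ⟨γ, α, β, h1, h2, h3, h4 ▸ hL⟩

lemma IsHorizontal.ccDist_le {m : ℕ} {γ : ℝ → ℂ × ℝ} {α β : ℝ → ℝ}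
    (h : IsHorizontal m γ α β) : ccDist m (γ 0) (γ 1) ≤ horizontalLength α β :=
  sInf_le ⟨γ, α, β, h, rfl, rfl, rfl⟩

/-- Carnot–Carathéodory balls are contained in boxes. -/
lemma inBox_of_ccDist_lt {m : ℕ} {p q : ℂ × ℝ} {r : ℝ}
    (h : ccDist m p q < ENNReal.ofReal r) : InBox m ((2 * m + 1) * r) p q := by
  have hr : 0 < r := ENNReal.ofReal_pos.1 (bot_le.trans_lt h)
  obtain ⟨γ, α, β, hγ, rfl, rfl, hL⟩ := exists_isHorizontal_of_ccDist_lt h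
  have hz : ∀ t ∈ Icc (0 : ℝ) 1, ‖(γ t).1 - (γ 0).1‖ ≤ r := fun t ht =>
    hγ.norm_fst_sub_le hr.le hL.le ht
  set p := γ 0 with hp
  have hk : (1 : ℝ) ≤ 2 * m + 1 := by
    have : (0 : ℝ) ≤ m := Nat.cast_nonneg m
    linarith
  have h1 : (1 : ℝ) ∈ Icc (0 : ℝ) 1 := ⟨zero_le_one, le_rfl⟩
  refine ⟨(hz 1 h1).trans (le_mul_of_one_le_left hr.le hk), ?_⟩
  refine le_trans ?_ (mul_vsize_le m _ hr.le hk)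
  let ℓ : ℂ × ℝ →L[ℝ] ℝ := ContinuousLinearMap.snd ℝ ℂ ℝ -
    (lin m p.1).comp (ContinuousLinearMap.fst ℝ ℂ ℝ)
  set B : ℝ := (2 * m + 1) * (‖p.1‖ + r) ^ (2 * m) * r with hB
  have key := ofReal_abs_sub_le_lintegral (f := fun s => ℓ (γ s))
    (g := fun s => ℓ (α s • X m (γ s) + β s • Y m (γ s)))
    (h := fun s => Real.sqrt (α s ^ 2 + β s ^ 2)) (B := B)
    (absolutelyContinuousOnInterval_clm_comp hγ.absolutelyContinuous ℓ) h1 (by positivity) (by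
      filter_upwards [hγ.hasDerivAt, ae_restrict_mem measurableSet_Icc] with s hs hs'
      refine ⟨ℓ.hasFDerivAt.comp_hasDerivAt s hs, ?_⟩
      rw [smul_X_add_smul_Y]
      have e : ℓ (⟨α s, β s⟩, lin m (γ s).1 ⟨α s, β s⟩) =
        lin m (γ s).1 ⟨α s, β s⟩ - lin m p.1 ⟨α s, β s⟩ := by simp [ℓ]
      rw [e]
      have hzs := hz s hs'
      have hzs' : ‖(γ s).1‖ ≤ ‖p.1‖ + r := by
        have := norm_add_le p.1 ((γ s).1 - p.1)
        rw [add_sub_cancel] at this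
        linarith
      refine (abs_lin_sub_lin_le (by linarith) hzs' _).trans ?_
      rw [← Complex.norm_eq_sqrt_sq_add_sq (⟨α s, β s⟩ : ℂ)]
      rw [hB]
      gcongr)
  have e : ℓ (γ 1) - ℓ (γ 0) = (γ 1).2 - p.2 - lin m p.1 ((γ 1).1 - p.1) := by
    simp only [ℓ, ← map_sub, ← hp]
    simp
  simp only [e] at key
  have key2 : ENNReal.ofReal |(γ 1).2 - p.2 - lin m p.1 ((γ 1).1 - p.1)| ≤
      ENNReal.ofReal (B * r) := by
    rw [ENNReal.ofReal_mul (by positivity)]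
    exact key.trans (by gcongr; exact hL.le)
  rw [ENNReal.ofReal_le_ofReal_iff (by positivity)] at key2
  refine key2.trans (le_of_eq ?_)
  rw [hB, vsize]; ring

/-- A smooth horizontal curve with speed at most `L` bounds the distance of its end points. -/
lemma ccDist_le_of_contDiff {m : ℕ} {γ : ℝ → ℂ × ℝ} {v : ℝ → ℂ} {L : ℝ} (hγ : ContDiff ℝ 1 γ)
    (hd : ∀ s, HasDerivAt γ (v s, lin m (γ s).1 (v s)) s) (hv : ∀ s, ‖v s‖ ≤ L) :
    ccDist m (γ 0) (γ 1) ≤ ENNReal.ofReal L := by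
  have h : IsHorizontal m γ (fun s => (v s).re) (fun s => (v s).im) :=
    ⟨hγ.contDiffOn.absolutelyContinuousOnInterval, Eventually.of_forall fun s => by
      rw [smul_X_add_smul_Y]; exact hd s⟩
  refine h.ccDist_le.trans ?_
  unfold horizontalLength
  calc _ ≤ ∫⁻ _ in Icc (0 : ℝ) 1, ENNReal.ofReal L := by
        refine lintegral_mono fun s => ENNReal.ofReal_le_ofReal ?_
        rw [← Complex.norm_eq_sqrt_sq_add_sq]; exact hv s
    _ = _ := by simp

lemma ccDist_self (m : ℕ) (p : ℂ × ℝ) : ccDist m p p = 0 := by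
  have := ccDist_le_of_contDiff (m := m) (γ := fun _ => p) (v := fun _ => 0) (L := 0)
    contDiff_const (fun s => by simpa using! hasDerivAt_const s p) (by simp)
  simpa using this

lemma map_two_mul_sub_volume (b : ℝ) :
    Measure.map (fun s : ℝ => 2 * s - b) volume = (2⁻¹ : ENNReal) • (volume : Measure ℝ) := by
  have e : (fun s : ℝ => 2 * s - b) = (fun s => s - b) ∘ (fun s => 2 * s) := rfl
  rw [e, ← Measure.map_map (by fun_prop) (by fun_prop), Real.map_volume_mul_left two_ne_zero,
    Measure.map_smul, (measurePreserving_sub_right volume b).map_eq]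
  congr 1
  rw [abs_of_pos (by norm_num), ENNReal.ofReal_inv_of_pos two_pos]
  simp

lemma lintegral_comp_two_mul_sub (b : ℝ) (F : ℝ → ENNReal) :
    ∫⁻ s, 2 * F (2 * s - b) = ∫⁻ s, F s := by
  have he : MeasurableEmbedding (fun s : ℝ => 2 * s - b) :=
    (((Homeomorph.mulLeft₀ (2 : ℝ) two_ne_zero).trans (Homeomorph.subRight b))).measurableEmbedding
  rw [lintegral_const_mul' _ _ (by simp), ← he.lintegral_map, map_two_mul_sub_volume,
    lintegral_smul_measure, smul_eq_mul, ← mul_assoc, ENNReal.mul_inv_cancel (by simp) (by simp),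
    one_mul]

lemma ae_comp_two_mul_sub (b : ℝ) {P : ℝ → Prop} (h : ∀ᵐ s : ℝ, P s) :
    ∀ᵐ s : ℝ, P (2 * s - b) := by
  refine ae_of_ae_map (f := fun s : ℝ => 2 * s - b) (by fun_prop) ?_
  rw [map_two_mul_sub_volume]
  exact Measure.ae_smul_measure h _

/-- The curve `γ₁` followed by `γ₂`, each traversed in half of the time, written as a sum so that
its regularity is that of a sum. -/
def concat (γ₁ γ₂ : ℝ → ℂ × ℝ) (s : ℝ) : ℂ × ℝ :=
  γ₁ (min (2 * s) 1) + (γ₂ (max (2 * s - 1) 0) - γ₂ 0)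

lemma concat_of_le (γ₁ γ₂ : ℝ → ℂ × ℝ) {s : ℝ} (hs : s ≤ 1 / 2) :
    concat γ₁ γ₂ s = γ₁ (2 * s) := by
  simp [concat, min_eq_left (by linarith : 2 * s ≤ 1), max_eq_right (by linarith : 2 * s - 1 ≤ 0)]

lemma concat_of_ge {γ₁ γ₂ : ℝ → ℂ × ℝ} (h : γ₁ 1 = γ₂ 0) {s : ℝ} (hs : 1 / 2 ≤ s) :
    concat γ₁ γ₂ s = γ₂ (2 * s - 1) := by
  simp [concat, min_eq_right (by linarith : 1 ≤ 2 * s), max_eq_left (by linarith : 0 ≤ 2 * s - 1),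
    h]

/-- The triangle inequality, by concatenation of horizontal curves. -/
lemma ccDist_triangle (m : ℕ) (p q r : ℂ × ℝ) :
    ccDist m p r ≤ ccDist m p q + ccDist m q r := by
  refine ENNReal.le_of_forall_pos_le_add fun ε hε hfin => ?_
  have hε2 : (0 : ENNReal) < (ε : ENNReal) / 2 := by
    simpa using hε.ne'
  have hfin1 : ccDist m p q ≠ ⊤ := fun h => by simp [h] at hfin
  have hfin2 : ccDist m q r ≠ ⊤ := fun h => by simp [h] at hfin
  obtain ⟨γ₁, α₁, β₁, ⟨hac₁, hd₁⟩, hp, hq, hL₁⟩ :=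
    exists_isHorizontal_of_ccDist_lt (ENNReal.lt_add_right hfin1 hε2.ne')
  obtain ⟨γ₂, α₂, β₂, ⟨hac₂, hd₂⟩, hq', hr, hL₂⟩ :=
    exists_isHorizontal_of_ccDist_lt (ENNReal.lt_add_right hfin2 hε2.ne')
  have hx : γ₁ 1 = γ₂ 0 := hq.trans hq'.symm
  let γ : ℝ → ℂ × ℝ := concat γ₁ γ₂
  let α : ℝ → ℝ := fun s => if s < 1 / 2 then 2 * α₁ (2 * s) else 2 * α₂ (2 * s - 1)
  let β : ℝ → ℝ := fun s => if s < 1 / 2 then 2 * β₁ (2 * s) else 2 * β₂ (2 * s - 1)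
  have hl : LipschitzWith 2 (fun s : ℝ => 2 * s) := LipschitzWith.of_dist_le_mul fun x y => by
    simp [Real.dist_eq, ← mul_sub, abs_mul]
  have hγ₁ : ∀ s : ℝ, s < 1 / 2 → γ =ᶠ[𝓝 s] fun u => γ₁ (2 * u) := fun s hs => by
    filter_upwards [Iio_mem_nhds hs] with u hu using concat_of_le _ _ (le_of_lt hu)
  have hγ₂ : ∀ s : ℝ, 1 / 2 < s → γ =ᶠ[𝓝 s] fun u => γ₂ (2 * u - 1) := fun s hs => by
    filter_upwards [Ioi_mem_nhds hs] with u hu using concat_of_ge hx (le_of_lt hu)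
  have hac : AbsolutelyContinuousOnInterval γ 0 1 := by
    refine AbsolutelyContinuousOnInterval.add ?_ (AbsolutelyContinuousOnInterval.sub ?_ ?_)
    · refine absolutelyContinuousOnInterval_comp_of_monotone hac₁ (K := 2) ?_ (hl.min_const 1) ?_
      · exact fun x y h => min_le_min_right _ (by linarith)
      · rw [uIcc_of_le zero_le_one]
        exact fun x hx => ⟨le_min (by linarith [hx.1]) zero_le_one, min_le_right _ _⟩
    · refine absolutelyContinuousOnInterval_comp_of_monotone hac₂ (K := 2) ?_ (?_) ?_
      · exact fun x y h => max_le_max_right _ (by linarith)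
      · have : LipschitzWith 2 (fun s : ℝ => 2 * s - 1) := LipschitzWith.of_dist_le_mul fun x y => by
          simp [Real.dist_eq, ← mul_sub, abs_mul]
        exact this.max_const 0
      · rw [uIcc_of_le zero_le_one]
        exact fun x hx => ⟨le_max_right _ _, max_le (by linarith [hx.2]) zero_le_one⟩
    · exact (contDiff_const (n := 1)).contDiffOn.absolutelyContinuousOnInterval
  have hd : ∀ᵐ s ∂(volume.restrict (Icc (0 : ℝ) 1)),
      HasDerivAt γ (α s • X m (γ s) + β s • Y m (γ s)) s := by
    rw [ae_restrict_iff' measurableSet_Icc] at hd₁ hd₂ ⊢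
    have hne : ∀ᵐ s : ℝ, s ≠ 1 / 2 := by simp [ae_iff, measure_singleton]
    filter_upwards [ae_comp_two_mul_sub 0 hd₁, ae_comp_two_mul_sub 1 hd₂, hne] with s h1 h2 hs hs'
    rcases lt_or_gt_of_ne hs with hlt | hgt
    · rw [sub_zero] at h1
      have h := h1 ⟨by linarith [hs'.1], by linarith⟩
      have h' : HasDerivAt (fun u : ℝ => 2 * u) 2 s := by simpa using (hasDerivAt_id s).const_mul 2
      have hc := h.scomp s h'
      refine (hc.congr_of_eventuallyEq (hγ₁ s hlt)).congr_deriv ?_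
      rw [(hγ₁ s hlt).self_of_nhds]
      simp only [α, β, if_pos hlt, smul_add, smul_smul]
    · have h := h2 ⟨by linarith, by linarith [hs'.2]⟩
      have h' : HasDerivAt (fun u : ℝ => 2 * u - 1) 2 s := by
        simpa using ((hasDerivAt_id s).const_mul 2).sub_const 1
      have hc := h.scomp s h'
      refine (hc.congr_of_eventuallyEq (hγ₂ s hgt)).congr_deriv ?_
      rw [(hγ₂ s hgt).self_of_nhds]
      simp only [α, β, if_neg (not_lt.2 hgt.le), smul_add, smul_smul]
  have h0 : γ 0 = p := by
    rw [← hp]; exact (concat_of_le _ _ (by norm_num)).trans (by rw [mul_zero])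
  have h1 : γ 1 = r := by
    rw [← hr]; exact (concat_of_ge hx (by norm_num)).trans (by norm_num)
  have hH := (show IsHorizontal m γ α β from ⟨hac, hd⟩).ccDist_le
  rw [h0, h1] at hH
  have hscale : ∀ a b : ℝ, ENNReal.ofReal (Real.sqrt ((2 * a) ^ 2 + (2 * b) ^ 2)) =
      2 * ENNReal.ofReal (Real.sqrt (a ^ 2 + b ^ 2)) := fun a b => by
    rw [show (2 * a) ^ 2 + (2 * b) ^ 2 = 2 ^ 2 * (a ^ 2 + b ^ 2) by ring,
      Real.sqrt_mul (by positivity), Real.sqrt_sq two_pos.le, ENNReal.ofReal_mul two_pos.le]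
    simp
  have hlen : horizontalLength α β ≤ horizontalLength α₁ β₁ + horizontalLength α₂ β₂ := by
    have hcov : Icc (0 : ℝ) 1 ⊆ Ico 0 (1 / 2) ∪ Icc (1 / 2) 1 := fun s hs => by
      rcases lt_or_ge s (1 / 2) with h | h
      · exact Or.inl ⟨hs.1, h⟩
      · exact Or.inr ⟨h, hs.2⟩
    unfold horizontalLength
    refine (lintegral_mono_set hcov).trans ((lintegral_union_le _ _ _).trans (add_le_add ?_ ?_))
    · rw [← lintegral_indicator measurableSet_Ico, ← lintegral_indicator measurableSet_Icc,
        ← lintegral_comp_two_mul_sub 0 ((Icc 0 1).indicator fun s =>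
          ENNReal.ofReal √(α₁ s ^ 2 + β₁ s ^ 2))]
      refine lintegral_mono fun s => ?_
      by_cases hs : s ∈ Ico (0 : ℝ) (1 / 2)
      swap
      · rw [indicator_of_notMem hs]; exact zero_le
      have hs' : 2 * s ∈ Icc (0 : ℝ) 1 := ⟨by linarith [hs.1], by linarith [hs.2]⟩
      rw [sub_zero, indicator_of_mem hs, indicator_of_mem hs', ← hscale]
      simp only [α, β, if_pos hs.2, le_refl]
    · rw [← lintegral_indicator measurableSet_Icc, ← lintegral_indicator measurableSet_Icc,
        ← lintegral_comp_two_mul_sub 1 ((Icc 0 1).indicator fun s =>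
          ENNReal.ofReal √(α₂ s ^ 2 + β₂ s ^ 2))]
      refine lintegral_mono fun s => ?_
      by_cases hs : s ∈ Icc (1 / 2 : ℝ) 1
      swap
      · rw [indicator_of_notMem hs]; exact zero_le
      have hs' : 2 * s - 1 ∈ Icc (0 : ℝ) 1 := ⟨by linarith [hs.1], by linarith [hs.2]⟩
      rw [indicator_of_mem hs, indicator_of_mem hs', ← hscale]
      simp only [α, β, if_neg (not_lt.2 hs.1), le_refl]
  calc ccDist m p r ≤ horizontalLength α₁ β₁ + horizontalLength α₂ β₂ := hH.trans hlen
    _ ≤ (ccDist m p q + ε / 2) + (ccDist m q r + ε / 2) := add_le_add hL₁.le hL₂.le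
    _ = ccDist m p q + ccDist m q r + (ε / 2 + ε / 2) := by ring
    _ = _ := by rw [ENNReal.add_halves]

/-- Horizontal lifts of planar segments. -/
lemma exists_ccDist_le_norm (m : ℕ) (p : ℂ × ℝ) (w : ℂ) :
    ∃ c, ccDist m p (pt m p w c) ≤ ENNReal.ofReal ‖w‖ := by
  have hcont : Continuous fun u : ℝ => lin m (p.1 + u • w) w := by
    simp only [lin_apply]
    fun_prop
  let τ : ℝ → ℝ := fun s => ∫ u in (0 : ℝ)..s, lin m (p.1 + u • w) w
  have hτ : ∀ s, HasDerivAt τ (lin m (p.1 + s • w) w) s := fun s =>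
    intervalIntegral.integral_hasDerivAt_right (hcont.intervalIntegrable _ _)
      (hcont.stronglyMeasurableAtFilter _ _) hcont.continuousAt
  let γ : ℝ → ℂ × ℝ := fun s => (p.1 + s • w, p.2 + τ s)
  have hγ : ∀ s, HasDerivAt γ (w, lin m (γ s).1 w) s := fun s => by
    refine HasDerivAt.prodMk ?_ ((hτ s).const_add _)
    simpa using ((hasDerivAt_id s).smul_const w).const_add p.1
  have hc1 : ContDiff ℝ 1 γ := by
    rw [contDiff_one_iff_deriv]
    refine ⟨fun s => (hγ s).differentiableAt, ?_⟩
    rw [show deriv γ = fun s => (w, lin m (γ s).1 w) from funext fun s => (hγ s).deriv]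
    exact continuous_const.prodMk hcont
  have h := ccDist_le_of_contDiff hc1 (v := fun _ => w) hγ (fun _ => le_rfl)
  refine ⟨τ 1 - lin m p.1 w, ?_⟩
  convert h using 2
  · simp [γ, τ]
  · ext1
    · simp [γ, pt]
    · simp [γ, pt]

/-- Rotations about the vertical axis. -/
lemma ccDist_rotate_le (m : ℕ) {ρ : ℝ} (hρ : 0 ≤ ρ) (θ ψ t : ℝ) :
    ccDist m (ρ * Complex.exp (θ * Complex.I), t)
      (ρ * Complex.exp ((θ + ψ : ℝ) * Complex.I), t - ρ ^ (2 * m + 2) * ψ) ≤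
      ENNReal.ofReal (ρ * |ψ|) := by
  let z : ℝ → ℂ := fun s => ρ * Complex.exp ((θ + s * ψ : ℝ) * Complex.I)
  have hn : ∀ s, ‖z s‖ = ρ := fun s => by
    simp only [z, norm_mul, Complex.norm_exp_ofReal_mul_I, Complex.norm_real, Real.norm_eq_abs,
      abs_of_nonneg hρ, mul_one]
  have hz : ∀ s, HasDerivAt z (z s * (ψ * Complex.I)) s := fun s => by
    have h1 : HasDerivAt (fun s : ℝ => θ + s * ψ) ψ s := by
      simpa using ((hasDerivAt_id s).mul_const ψ).const_add θ
    have h2 := ((h1.ofReal_comp.mul_const Complex.I).cexp).const_mul (ρ : ℂ)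
    simpa only [z, mul_assoc] using h2
  have hlin : ∀ s, lin m (z s) (z s * (ψ * Complex.I)) = -(ρ ^ (2 * m + 2) * ψ) := fun s => by
    rw [lin_apply, hn]
    have : (z s).re * (z s).re + (z s).im * (z s).im = ρ ^ 2 := by
      rw [← Complex.normSq_apply, Complex.normSq_eq_norm_sq, hn]
    simp only [Complex.mul_re, Complex.mul_im, Complex.ofReal_re, Complex.ofReal_im, Complex.I_re,
      Complex.I_im]
    linear_combination (-(ρ ^ (2 * m)) * ψ) * this
  let γ : ℝ → ℂ × ℝ := fun s => (z s, t - ρ ^ (2 * m + 2) * ψ * s)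
  have hγ : ∀ s, HasDerivAt γ (z s * (ψ * Complex.I), lin m (γ s).1 (z s * (ψ * Complex.I))) s :=
    fun s => by
      refine (hz s).prodMk ?_
      rw [hlin]
      simpa using ((hasDerivAt_id s).const_mul (ρ ^ (2 * m + 2) * ψ)).const_sub t
  have hc1 : ContDiff ℝ 1 γ := by
    refine ContDiff.prodMk ?_ (by fun_prop)
    exact contDiff_const.mul (Complex.contDiff_exp.comp
      ((Complex.ofRealCLM.contDiff.comp
        (contDiff_const.add (contDiff_id.mul contDiff_const))).mul contDiff_const))
  have h := ccDist_le_of_contDiff hc1 hγ (L := ρ * |ψ|) (fun s => by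
    rw [norm_mul, hn, norm_mul, Complex.norm_I, Complex.norm_real, mul_one, Real.norm_eq_abs])
  simpa [γ, z] using h

/-- Radial motions. -/
lemma ccDist_radial_le (m : ℕ) (ρ ρ' θ t : ℝ) :
    ccDist m (ρ * Complex.exp (θ * Complex.I), t) (ρ' * Complex.exp (θ * Complex.I), t) ≤
      ENNReal.ofReal |ρ' - ρ| := by
  set e := Complex.exp (θ * Complex.I) with he
  let z : ℝ → ℂ := fun s => (ρ + s * (ρ' - ρ) : ℝ) * e
  have hz : ∀ s, HasDerivAt z ((ρ' - ρ : ℝ) * e) s := fun s => by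
    have h1 : HasDerivAt (fun s : ℝ => ρ + s * (ρ' - ρ)) (ρ' - ρ) s := by
      simpa using ((hasDerivAt_id s).mul_const (ρ' - ρ)).const_add ρ
    exact h1.ofReal_comp.mul_const e
  have hlin : ∀ s, lin m (z s) ((ρ' - ρ : ℝ) * e) = 0 := fun s => by
    rw [lin_apply]
    simp only [z, Complex.re_ofReal_mul, Complex.im_ofReal_mul]
    ring
  have h := ccDist_le_of_contDiff (m := m) (γ := fun s => (z s, t))
    (v := fun _ => (ρ' - ρ : ℝ) * e) (L := |ρ' - ρ|)
    (ContDiff.prodMk (((Complex.ofRealCLM.contDiff.comp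
      (contDiff_const.add (contDiff_id.mul contDiff_const))).mul contDiff_const)) contDiff_const)
    (fun s => (hz s).prodMk (by rw [hlin]; exact hasDerivAt_const s t))
    (fun s => by rw [norm_mul, he, Complex.norm_exp_ofReal_mul_I, Complex.norm_real,
      Real.norm_eq_abs, mul_one])
  simpa [z] using h

/-- Vertical motions: travel outwards by `R`, rotate by an angle, travel back inwards and rotate
back. The area so enclosed produces the vertical displacement `c`. -/
lemma ccDist_vertical_le (m : ℕ) (z : ℂ) (t : ℝ) {c R B : ℝ} (hR : 0 < R) (hB : 0 ≤ B)
    (hc : |c| ≤ B * vsize m z R) :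
    ccDist m (z, t) (z, t + c) ≤ ENNReal.ofReal ((2 + 2 * B) * R) := by
  set ρ := ‖z‖ with hρ
  have hρ0 : 0 ≤ ρ := norm_nonneg z
  set ρ' := ρ + R with hρ'
  have hρ'0 : 0 < ρ' := by positivity
  set θ := Complex.arg z with hθ
  have hz : z = ρ * Complex.exp (θ * Complex.I) := (Complex.norm_mul_exp_arg_mul_I z).symm
  set D := ρ' ^ (2 * m + 2) - ρ ^ (2 * m + 2) with hD
  have hDlow : R * ρ' ^ (2 * m + 1) ≤ D := by
    have h : ρ ^ (2 * m + 1) ≤ ρ' ^ (2 * m + 1) := by gcongr; linarith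
    calc R * ρ' ^ (2 * m + 1) = ρ' ^ (2 * m + 1) * ρ' - ρ' ^ (2 * m + 1) * ρ := by rw [hρ']; ring
      _ ≤ ρ' ^ (2 * m + 1) * ρ' - ρ ^ (2 * m + 1) * ρ := by gcongr
      _ = D := by rw [hD]; ring
  have hDpos : 0 < D := lt_of_lt_of_le (by positivity) hDlow
  set ψ := -c / D with hψ
  have hψD : D * ψ = -c := by rw [hψ]; field_simp
  have hψle : ρ' * |ψ| ≤ B * R := by
    have h1 : |ψ| = |c| / D := by rw [hψ, abs_div, abs_neg, abs_of_pos hDpos]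
    rw [h1, mul_div_assoc', div_le_iff₀ hDpos]
    calc ρ' * |c| ≤ ρ' * (B * (R ^ 2 * ρ' ^ (2 * m))) := by gcongr; exact hc
      _ = B * R * (R * ρ' ^ (2 * m + 1)) := by ring
      _ ≤ _ := by gcongr
  have hψle' : ρ * |ψ| ≤ B * R := le_trans (by gcongr; linarith) hψle
  have h1 := ccDist_radial_le m ρ ρ' θ t
  have h2 := ccDist_rotate_le m hρ'0.le θ ψ t
  have h3 := ccDist_radial_le m ρ' ρ (θ + ψ) (t - ρ' ^ (2 * m + 2) * ψ)
  have h4 := ccDist_rotate_le m hρ0 (θ + ψ) (-ψ) (t - ρ' ^ (2 * m + 2) * ψ)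
  have e4 : t - ρ' ^ (2 * m + 2) * ψ - ρ ^ (2 * m + 2) * -ψ = t + c := by
    linear_combination -hψD
  rw [e4, add_neg_cancel_right, ← hz, abs_neg] at h4
  rw [← hz, show ρ' - ρ = R by rw [hρ']; ring, abs_of_pos hR] at h1
  rw [show ρ - ρ' = -R by rw [hρ']; ring, abs_neg, abs_of_pos hR] at h3
  calc ccDist m (z, t) (z, t + c)
      ≤ ENNReal.ofReal R + (ENNReal.ofReal (B * R) +
          (ENNReal.ofReal R + ENNReal.ofReal (B * R))) := by
        refine (ccDist_triangle m _ _ _).trans (add_le_add h1 ?_)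
        refine (ccDist_triangle m _ _ _).trans
          (add_le_add (h2.trans (ENNReal.ofReal_le_ofReal hψle)) ?_)
        exact (ccDist_triangle m _ _ _).trans
          (add_le_add h3 (h4.trans (ENNReal.ofReal_le_ofReal hψle')))
    _ = _ := by
        rw [← ENNReal.ofReal_add (by positivity) (by positivity),
          ← ENNReal.ofReal_add (by positivity) (by positivity),
          ← ENNReal.ofReal_add (by positivity) (by positivity)]
        congr 1; ring

/-- Boxes are contained in Carnot–Carathéodory balls. -/
lemma ccDist_le_of_inBox {m : ℕ} {p q : ℂ × ℝ} {r : ℝ} (hr : 0 < r) (h : InBox m r p q) :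
    ccDist m p q ≤ ENNReal.ofReal ((36 * m + 19) * r) := by
  set w := q.1 - p.1 with hw
  obtain ⟨c, hc⟩ := exists_ccDist_le_norm m p w
  have hlt : ccDist m p (pt m p w c) < ENNReal.ofReal (2 * r) := by
    refine hc.trans_lt ((ENNReal.ofReal_lt_ofReal_iff (by positivity)).2 ?_)
    linarith [h.1]
  -- The end of the lifted segment lies in a box, which bounds its height error.
  have hbox := (inBox_pt.1 (inBox_of_ccDist_lt hlt)).2
  set k : ℝ := 2 * m + 1 with hk
  have hk1 : 1 ≤ k := by
    have : (0 : ℝ) ≤ m := Nat.cast_nonneg m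
    linarith
  set R : ℝ := 3 * k * r with hR
  have hz : ‖p.1‖ ≤ ‖q.1‖ + r := by
    have := norm_sub_le q.1 w
    rw [hw, sub_sub_cancel] at this
    linarith [h.1]
  have hsize : vsize m p.1 (k * (2 * r)) ≤ vsize m q.1 R := by
    unfold vsize
    have h1 : k * (2 * r) ≤ R := by rw [hR]; nlinarith
    have h2 : ‖p.1‖ + k * (2 * r) ≤ ‖q.1‖ + R := by rw [hR]; nlinarith
    gcongr
  have hsize' : vsize m p.1 r ≤ vsize m p.1 (k * (2 * r)) :=
    vsize_mono m _ hr.le (by nlinarith)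
  set c' : ℝ := q.2 - p.2 - lin m p.1 w with hc'
  have hq : q = (q.1, (pt m p w c).2 + (c' - c)) := by
    ext1
    · rfl
    · simp only [pt, hc']; ring
  have hpt : pt m p w c = (q.1, (pt m p w c).2) := by
    ext1
    · simp [pt, hw]
    · rfl
  have hv : ccDist m (pt m p w c) q ≤ ENNReal.ofReal ((2 + 2 * 2) * R) := by
    conv_lhs => rw [hq, hpt]
    refine ccDist_vertical_le m _ _ (by positivity) two_pos.le ?_
    have := abs_sub c' c
    linarith [h.2]
  calc ccDist m p q ≤ ENNReal.ofReal r + ENNReal.ofReal ((2 + 2 * 2) * R) :=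
        (ccDist_triangle m _ _ _).trans
          (add_le_add (hc.trans (ENNReal.ofReal_le_ofReal h.1)) hv)
    _ = _ := by
        rw [← ENNReal.ofReal_add hr.le (by positivity)]
        congr 1; rw [hR, hk]; ring

/-! ### Comparison with the Euclidean topology -/

/-- A modulus that controls Euclidean distances inside a box of radius `r` centred over a point
of modulus `ρ`. -/
def boxModulus (m : ℕ) (r ρ : ℝ) : ℝ :=
  r + (r ^ 2 * (ρ + r) ^ (2 * m) + (2 * m + 1) * ρ ^ (2 * m) * ρ * r)

lemma abs_lin_le (m : ℕ) (z w : ℂ) : |lin m z w| ≤ (2 * m + 1) * ‖z‖ ^ (2 * m) * ‖z‖ * ‖w‖ := by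
  have h := abs_lin_sub_lin_le (m := m) (z := 0) (z' := z) (ρ := ‖z‖) (by simp) le_rfl w
  have h0 : lin m 0 w = 0 := by simp [lin_apply]
  simpa [h0] using h

lemma InBox.dist_le {m : ℕ} {r : ℝ} {p q : ℂ × ℝ} (h : InBox m r p q) :
    dist q p ≤ boxModulus m r ‖p.1‖ := by
  have hr : 0 ≤ r := (norm_nonneg _).trans h.1
  have h1 : |q.2 - p.2| ≤ vsize m p.1 r + (2 * m + 1) * ‖p.1‖ ^ (2 * m) * ‖p.1‖ * r := by
    have h2 := (abs_lin_le m p.1 (q.1 - p.1)).trans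
      (mul_le_mul_of_nonneg_left h.1 (by positivity))
    have h3 := abs_add_le (q.2 - p.2 - lin m p.1 (q.1 - p.1)) (lin m p.1 (q.1 - p.1))
    rw [sub_add_cancel] at h3
    linarith [h.2]
  rw [Prod.dist_eq, dist_eq_norm, Real.dist_eq]
  unfold boxModulus
  refine max_le ?_ ?_
  · have := h.1
    have : 0 ≤ r ^ 2 * (‖p.1‖ + r) ^ (2 * m) + (2 * m + 1) * ‖p.1‖ ^ (2 * m) * ‖p.1‖ * r := by
      positivity
    linarith
  · exact h1.trans (le_add_of_nonneg_left hr)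

/-- Near a given point, boxes of small radius are small in the Euclidean sense. -/
lemma exists_nhds_inBox_mem (m : ℕ) {p₀ : ℂ × ℝ} {W : Set (ℂ × ℝ)} (hW : W ∈ 𝓝 p₀) :
    ∃ η > 0, ∃ V ∈ 𝓝 p₀, ∀ p ∈ V, ∀ r ≤ η, ∀ q, InBox m r p q → q ∈ W := by
  obtain ⟨δ, hδ, hδW⟩ := Metric.mem_nhds_iff.1 hW
  have hcont : Continuous fun a : ℝ × (ℂ × ℝ) => boxModulus m a.1 ‖a.2.1‖ := by
    unfold boxModulus; fun_prop
  have h0 : boxModulus m 0 ‖p₀.1‖ < δ / 2 := by simpa [boxModulus] using hδ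
  have hev := (hcont.tendsto (0, p₀)).eventually_lt_const h0
  rw [nhds_prod_eq, Filter.eventually_prod_iff] at hev
  obtain ⟨P, hP, Q, hQ, hPQ⟩ := hev
  obtain ⟨η, hη, hηP⟩ := Metric.eventually_nhds_iff.1 hP
  refine ⟨η / 2, half_pos hη, {p | Q p} ∩ Metric.ball p₀ (δ / 2),
    inter_mem hQ (Metric.ball_mem_nhds _ (half_pos hδ)), fun p hp r hr q hq => hδW ?_⟩
  have hr0 : 0 ≤ r := (norm_nonneg _).trans hq.1
  have h1 : boxModulus m r ‖p.1‖ < δ / 2 :=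
    hPQ (hηP (by rw [Real.dist_eq, sub_zero, abs_of_nonneg hr0]; linarith)) hp.1
  have h2 := hq.dist_le
  have h3 : dist p p₀ < δ / 2 := hp.2
  have := dist_triangle q p p₀
  rw [Metric.mem_ball]
  linarith

lemma ccBall_subset_of_forall_inBox {m : ℕ} {p : ℂ × ℝ} {r : ℝ} {W : Set (ℂ × ℝ)}
    (h : ∀ q, InBox m ((2 * m + 1) * r) p q → q ∈ W) : ccBall m p (ENNReal.ofReal r) ⊆ W :=
  fun _ hq => h _ (inBox_of_ccDist_lt hq)

/-- Near a given point, Carnot–Carathéodory balls of small radius are small in the Euclidean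
sense. -/
lemma exists_nhds_ccBall_subset (m : ℕ) {p₀ : ℂ × ℝ} {W : Set (ℂ × ℝ)} (hW : W ∈ 𝓝 p₀) :
    ∃ η > 0, ∃ V ∈ 𝓝 p₀, ∀ p ∈ V, ccBall m p (ENNReal.ofReal η) ⊆ W := by
  obtain ⟨η, hη, V, hV, h⟩ := exists_nhds_inBox_mem m hW
  have hk : (0 : ℝ) < 2 * m + 1 := by positivity
  refine ⟨η / (2 * m + 1), by positivity, V, hV, fun p hp => ccBall_subset_of_forall_inBox
    fun q hq => h p hp η le_rfl q ?_⟩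
  rwa [mul_div_cancel₀ _ hk.ne'] at hq

/-- Points that are close to `p₀` for the Carnot–Carathéodory distance have balls of a fixed
radius inside a given neighborhood of `p₀`. -/
lemma exists_forall_ccDist_lt_ccBall_subset (m : ℕ) {p₀ : ℂ × ℝ} {W : Set (ℂ × ℝ)}
    (hW : W ∈ 𝓝 p₀) :
    ∃ η > 0, ∀ p, ccDist m p p₀ < ENNReal.ofReal η → ccBall m p (ENNReal.ofReal η) ⊆ W := by
  obtain ⟨η, hη, V, hV, h⟩ := exists_nhds_inBox_mem m hW
  have hk : (0 : ℝ) < (4 * m + 4) * (2 * (2 * m + 1)) := by positivity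
  refine ⟨η / ((4 * m + 4) * (2 * (2 * m + 1))), by positivity, fun p hp =>
    ccBall_subset_of_forall_inBox fun q hq =>
      h p₀ (mem_of_mem_nhds hV) η le_rfl q ?_⟩
  have := (inBox_of_ccDist_lt hp).trans_common hq
  convert this using 1
  field_simp

lemma exists_ccBall_subset_of_isCompact (m : ℕ) {S Ω : Set (ℂ × ℝ)} (hS : IsCompact S)
    (hΩ : IsOpen Ω) (hSΩ : S ⊆ Ω) :
    ∃ η > 0, ∀ p ∈ S, ccBall m p (ENNReal.ofReal η) ⊆ Ω := by
  refine hS.induction_on (p := fun T => ∃ η > 0, ∀ p ∈ T, ccBall m p (ENNReal.ofReal η) ⊆ Ω)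
    ⟨1, one_pos, by simp⟩ (fun s t hst ⟨η, hη, h⟩ => ⟨η, hη, fun p hp => h p (hst hp)⟩) ?_ ?_
  · rintro s t ⟨η, hη, h⟩ ⟨η', hη', h'⟩
    refine ⟨min η η', lt_min hη hη', ?_⟩
    rintro p (hp | hp) q hq
    · exact h p hp (hq.trans_le (ENNReal.ofReal_le_ofReal (min_le_left _ _)))
    · exact h' p hp (hq.trans_le (ENNReal.ofReal_le_ofReal (min_le_right _ _)))
  · intro p hp
    obtain ⟨η, hη, V, hV, h⟩ := exists_nhds_ccBall_subset m (hΩ.mem_nhds (hSΩ hp))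
    exact ⟨V, mem_nhdsWithin_of_mem_nhds hV, η, hη, h⟩

/-- The Carnot–Carathéodory distance is continuous on the diagonal. -/
lemma exists_nhds_ccDist_lt (m : ℕ) (p₀ : ℂ × ℝ) {η : ℝ} (hη : 0 < η) :
    ∃ V ∈ 𝓝 p₀, ∀ p ∈ V, ∀ q ∈ V, ccDist m p q < ENNReal.ofReal η := by
  set r : ℝ := η / (2 * (36 * m + 19)) with hr
  have hr0 : 0 < r := by positivity
  have hc1 : Continuous fun a : (ℂ × ℝ) × (ℂ × ℝ) => ‖a.2.1 - a.1.1‖ := by fun_prop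
  have hc2 : Continuous fun a : (ℂ × ℝ) × (ℂ × ℝ) =>
      |a.2.2 - a.1.2 - lin m a.1.1 (a.2.1 - a.1.1)| := by
    simp only [lin_apply]; fun_prop
  have h1 := (hc1.tendsto (p₀, p₀)).eventually_lt_const (u := r) (by simpa using hr0)
  have h2 := (hc2.tendsto (p₀, p₀)).eventually_lt_const (u := r ^ 2 * r ^ (2 * m))
    (by simpa using by positivity)
  have h3 := h1.and h2
  rw [nhds_prod_eq, Filter.Eventually, Filter.mem_prod_self_iff] at h3
  obtain ⟨V, hV, h⟩ := h3
  refine ⟨V, hV, fun p hp q hq => ?_⟩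
  have hpq := h (Set.mk_mem_prod hp hq)
  refine (ccDist_le_of_inBox hr0 ⟨hpq.1.le, hpq.2.le.trans ?_⟩).trans_lt ?_
  · unfold vsize
    gcongr
    linarith [norm_nonneg p.1]
  · rw [ENNReal.ofReal_lt_ofReal_iff hη, hr]
    field_simp
    linarith

lemma exists_ccDist_le_of_isBounded (m : ℕ) {S : Set (ℂ × ℝ)} (hS : Bornology.IsBounded S) :
    ∃ D > 0, ∀ p ∈ S, ∀ q ∈ S, ccDist m p q ≤ ENNReal.ofReal D := by
  obtain ⟨ρ, hρ⟩ := hS.exists_norm_le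
  set B : ℝ := 2 * |ρ| + (2 * m + 1) * |ρ| ^ (2 * m) * |ρ| * (2 * |ρ|) with hB
  set r : ℝ := 1 + B with hr
  have hB0 : 0 ≤ B := by positivity
  refine ⟨(36 * m + 19) * r, by positivity, fun p hp q hq => ccDist_le_of_inBox (by positivity) ?_⟩
  have hp' : ‖p‖ ≤ |ρ| := (hρ p hp).trans (le_abs_self ρ)
  have hq' : ‖q‖ ≤ |ρ| := (hρ q hq).trans (le_abs_self ρ)
  have h1 : ‖q.1 - p.1‖ ≤ 2 * |ρ| :=
    (norm_sub_le _ _).trans (by linarith [norm_fst_le p, norm_fst_le q])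
  have h2 : |q.2 - p.2| ≤ 2 * |ρ| :=
    (abs_sub _ _).trans (by
      have := norm_snd_le p
      have := norm_snd_le q
      rw [Real.norm_eq_abs] at *
      linarith)
  have h3 : |lin m p.1 (q.1 - p.1)| ≤ (2 * m + 1) * |ρ| ^ (2 * m) * |ρ| * (2 * |ρ|) := by
    refine (abs_lin_le m _ _).trans ?_
    have := (norm_fst_le p).trans hp'
    gcongr
  have h4 : (1 : ℝ) ≤ (‖p.1‖ + r) ^ (2 * m) := one_le_pow₀ (by
    have := norm_nonneg p.1
    linarith)
  refine ⟨h1.trans ?_, (abs_sub _ _).trans ?_⟩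
  · have : 0 ≤ (2 * m + 1) * |ρ| ^ (2 * m) * |ρ| * (2 * |ρ|) := by positivity
    linarith
  · unfold vsize
    calc _ ≤ r ^ 2 * 1 := by nlinarith
      _ ≤ _ := by gcongr

lemma ccDist_ne_top (m : ℕ) (p q : ℂ × ℝ) : ccDist m p q ≠ ⊤ := by
  obtain ⟨D, -, h⟩ := exists_ccDist_le_of_isBounded m
    (isCompact_singleton (x := p) |>.insert q).isBounded
  exact ne_top_of_le_ne_top ENNReal.ofReal_ne_top (h p (by simp) q (by simp))

lemma ccDist_pos (m : ℕ) {p q : ℂ × ℝ} (hpq : p ≠ q) : 0 < ccDist m p q := by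
  obtain ⟨η, hη, V, hV, h⟩ := exists_nhds_ccBall_subset m (p₀ := p) (W := {q}ᶜ)
    (isOpen_compl_singleton.mem_nhds hpq)
  by_contra! h0
  exact h p (mem_of_mem_nhds hV) (show ccDist m p q < _ from
    h0.trans_lt (ENNReal.ofReal_pos.2 hη)) rfl

/-! ### Gluing curves -/

lemma ccDist_le_curveDiam {m : ℕ} {γ : ℝ → ℂ × ℝ} {a b s s' : ℝ} (hs : s ∈ Icc a b)
    (hs' : s' ∈ Icc a b) : ccDist m (γ s) (γ s') ≤ curveDiam m γ a b :=
  le_iSup₂_of_le s hs (le_iSup₂_of_le s' hs' le_rfl)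

lemma curveDiam_le {m : ℕ} {γ : ℝ → ℂ × ℝ} {a b : ℝ} {D : ENNReal}
    (h : ∀ s ∈ Icc a b, ∀ s' ∈ Icc a b, ccDist m (γ s) (γ s') ≤ D) : curveDiam m γ a b ≤ D :=
  iSup₂_le fun s hs => iSup₂_le fun s' hs' => h s hs s' hs'

lemma curveDiam_le_of_forall_exists {m : ℕ} {γ γ' : ℝ → ℂ × ℝ} {a b a' b' : ℝ}
    (h : ∀ s ∈ Icc a b, ∃ u ∈ Icc a' b', γ s = γ' u) :
    curveDiam m γ a b ≤ curveDiam m γ' a' b' := by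
  refine curveDiam_le fun s hs s' hs' => ?_
  obtain ⟨u, hu, e⟩ := h s hs
  obtain ⟨u', hu', e'⟩ := h s' hs'
  rw [e, e']
  exact ccDist_le_curveDiam hu hu'

lemma curveDiam_mono {m : ℕ} {γ : ℝ → ℂ × ℝ} {a b a' b' : ℝ} (h : Icc a b ⊆ Icc a' b') :
    curveDiam m γ a b ≤ curveDiam m γ a' b' :=
  curveDiam_le_of_forall_exists fun s hs => ⟨s, h hs, rfl⟩

lemma IsCurveIn.concat {Ω : Set (ℂ × ℝ)} {γ₁ γ₂ : ℝ → ℂ × ℝ} {p x q : ℂ × ℝ}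
    (h₁ : IsCurveIn Ω γ₁ p x) (h₂ : IsCurveIn Ω γ₂ x q) : IsCurveIn Ω (concat γ₁ γ₂) p q := by
  have hx : γ₁ 1 = γ₂ 0 := h₁.target.trans h₂.source.symm
  refine ⟨?_, fun s hs => ?_, ?_, ?_⟩
  · refine ContinuousOn.add ?_ (ContinuousOn.sub ?_ continuousOn_const)
    · exact h₁.continuousOn.comp (by fun_prop) fun s hs =>
        ⟨le_min (by linarith [hs.1]) zero_le_one, min_le_right _ _⟩
    · exact h₂.continuousOn.comp (by fun_prop) fun s hs =>
        ⟨le_max_right _ _, max_le (by linarith [hs.2]) zero_le_one⟩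
  · rcases le_total s (1 / 2) with h | h
    · rw [concat_of_le _ _ h]
      exact h₁.mapsTo ⟨by linarith [hs.1], by linarith⟩
    · rw [concat_of_ge hx h]
      exact h₂.mapsTo ⟨by linarith, by linarith [hs.2]⟩
  · rw [concat_of_le _ _ (by norm_num), mul_zero, h₁.source]
  · rw [concat_of_ge hx (by norm_num), ← h₂.target]; norm_num

lemma IsCurveIn.reverse {Ω : Set (ℂ × ℝ)} {γ : ℝ → ℂ × ℝ} {p q : ℂ × ℝ}
    (h : IsCurveIn Ω γ p q) : IsCurveIn Ω (fun s => γ (1 - s)) q p := by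
  have hm : MapsTo (fun s : ℝ => 1 - s) (Icc 0 1) (Icc 0 1) := fun s hs =>
    ⟨by linarith [hs.2], by linarith [hs.1]⟩
  exact ⟨h.continuousOn.comp (by fun_prop) hm, fun s hs => h.mapsTo (hm hs), by simp [h.target],
    by simp [h.source]⟩

lemma curveDiam_reverse_le (m : ℕ) (γ : ℝ → ℂ × ℝ) (a b : ℝ) :
    curveDiam m (fun s => γ (1 - s)) a b ≤ curveDiam m γ (1 - b) (1 - a) :=
  curveDiam_le_of_forall_exists fun s hs => ⟨1 - s, ⟨by linarith [hs.2], by linarith [hs.1]⟩, rfl⟩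

lemma curveDiam_concat_le (m : ℕ) {γ₁ γ₂ : ℝ → ℂ × ℝ} (hx : γ₁ 1 = γ₂ 0) :
    curveDiam m (concat γ₁ γ₂) 0 1 ≤ curveDiam m γ₁ 0 1 + curveDiam m γ₂ 0 1 := by
  have h0 : (0 : ℝ) ∈ Icc (0 : ℝ) 1 := ⟨le_rfl, zero_le_one⟩
  have h1 : (1 : ℝ) ∈ Icc (0 : ℝ) 1 := ⟨zero_le_one, le_rfl⟩
  have hl : ∀ s ∈ Icc (0 : ℝ) 1, s ≤ 1 / 2 → 2 * s ∈ Icc (0 : ℝ) 1 := fun s hs h =>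
    ⟨by linarith [hs.1], by linarith⟩
  have hr : ∀ s ∈ Icc (0 : ℝ) 1, 1 / 2 ≤ s → 2 * s - 1 ∈ Icc (0 : ℝ) 1 := fun s hs h =>
    ⟨by linarith, by linarith [hs.2]⟩
  refine curveDiam_le fun s hs s' hs' => ?_
  rcases le_total s (1 / 2) with h | h <;> rcases le_total s' (1 / 2) with h' | h'
  · rw [concat_of_le _ _ h, concat_of_le _ _ h']
    exact (ccDist_le_curveDiam (hl s hs h) (hl s' hs' h')).trans le_self_add
  · rw [concat_of_le _ _ h, concat_of_ge hx h']
    refine (ccDist_triangle m _ (γ₁ 1) _).trans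
      (add_le_add (ccDist_le_curveDiam (hl s hs h) h1) ?_)
    rw [hx]
    exact ccDist_le_curveDiam h0 (hr s' hs' h')
  · rw [concat_of_ge hx h, concat_of_le _ _ h', add_comm]
    refine (ccDist_triangle m _ (γ₂ 0) _).trans
      (add_le_add (ccDist_le_curveDiam (hr s hs h) h0) ?_)
    rw [← hx]
    exact ccDist_le_curveDiam h1 (hl s' hs' h')
  · rw [concat_of_ge hx h, concat_of_ge hx h']
    exact (ccDist_le_curveDiam (hr s hs h) (hr s' hs' h')).trans le_add_self

lemma ccBall_mono {m : ℕ} {p : ℂ × ℝ} {r r' : ENNReal} (h : r ≤ r') :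
    ccBall m p r ⊆ ccBall m p r' := fun _ hq => lt_of_lt_of_le hq h

/-- There is a curve of `Ω` from `p` to `x`, of diameter at most `D`, along which the distance to
the complement of `Ω` is at least `ε` times the diameter of the part already covered. -/
def JohnArc (m : ℕ) (Ω : Set (ℂ × ℝ)) (ε D : ℝ) (p x : ℂ × ℝ) : Prop :=
  ∃ γ : ℝ → ℂ × ℝ, IsCurveIn Ω γ p x ∧ curveDiam m γ 0 1 ≤ ENNReal.ofReal D ∧
    ∀ t ∈ Icc (0 : ℝ) 1, ccBall m (γ t) (ENNReal.ofReal ε * curveDiam m γ 0 t) ⊆ Ω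

/-- There is a curve of `Ω` from `p` to `q`, of diameter at most `D`, along which the distance to
the complement of `Ω` is at least `ε` times the smaller of the diameters of the parts before and
after the point. -/
def UniformArc (m : ℕ) (Ω : Set (ℂ × ℝ)) (ε D : ℝ) (p q : ℂ × ℝ) : Prop :=
  ∃ γ : ℝ → ℂ × ℝ, IsCurveIn Ω γ p q ∧ curveDiam m γ 0 1 ≤ ENNReal.ofReal D ∧
    ∀ t ∈ Icc (0 : ℝ) 1,
      ccBall m (γ t) (ENNReal.ofReal ε * min (curveDiam m γ 0 t) (curveDiam m γ t 1)) ⊆ Ω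

/-- A John arc can be prolonged along a curve that stays at distance `ρ` from the complement. -/
lemma JohnArc.trans_curve {m : ℕ} {Ω : Set (ℂ × ℝ)} {ε ε' D D' ρ : ℝ} {p x y : ℂ × ℝ}
    {σ : ℝ → ℂ × ℝ} (h : JohnArc m Ω ε D p x) (hσ : IsCurveIn Ω σ x y)
    (hσD : curveDiam m σ 0 1 ≤ ENNReal.ofReal D')
    (hσρ : ∀ t ∈ Icc (0 : ℝ) 1, ccBall m (σ t) (ENNReal.ofReal ρ) ⊆ Ω)
    (hD : 0 ≤ D) (hD' : 0 ≤ D') (hε : 0 ≤ ε') (hεε : ε' ≤ ε) (hρ : ε' * (D + D') ≤ ρ) :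
    JohnArc m Ω ε' (D + D') p y := by
  obtain ⟨γ, hγ, hγD, hγε⟩ := h
  have hx : γ 1 = σ 0 := hγ.target.trans hσ.source.symm
  have htot : curveDiam m (concat γ σ) 0 1 ≤ ENNReal.ofReal (D + D') := by
    rw [ENNReal.ofReal_add hD hD']
    exact (curveDiam_concat_le m hx).trans (add_le_add hγD hσD)
  refine ⟨concat γ σ, hγ.concat hσ, htot, fun t ht => ?_⟩
  rcases le_total t (1 / 2) with h | h
  · have h2 : curveDiam m (concat γ σ) 0 t ≤ curveDiam m γ 0 (2 * t) :=
      curveDiam_le_of_forall_exists fun s hs => ⟨2 * s, ⟨by linarith [hs.1], by linarith [hs.2]⟩,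
        concat_of_le _ _ (by linarith [hs.2])⟩
    rw [concat_of_le _ _ h]
    refine (ccBall_mono ?_).trans (hγε (2 * t) ⟨by linarith [ht.1], by linarith⟩)
    gcongr
  · rw [concat_of_ge hx h]
    refine (ccBall_mono ?_).trans (hσρ (2 * t - 1) ⟨by linarith, by linarith [ht.2]⟩)
    calc _ ≤ ENNReal.ofReal ε' * ENNReal.ofReal (D + D') := by
          gcongr
          exact (curveDiam_mono (Icc_subset_Icc_right ht.2)).trans htot
      _ ≤ _ := by
          rw [← ENNReal.ofReal_mul hε]
          exact ENNReal.ofReal_le_ofReal hρ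

/-- Two John arcs that end at the same point form a uniform arc. -/
lemma JohnArc.uniformArc {m : ℕ} {Ω : Set (ℂ × ℝ)} {ε D : ℝ} {p q x : ℂ × ℝ} (hD : 0 ≤ D)
    (hp : JohnArc m Ω ε D p x) (hq : JohnArc m Ω ε D q x) : UniformArc m Ω ε (2 * D) p q := by
  obtain ⟨γ, hγ, hγD, hγε⟩ := hp
  obtain ⟨σ, hσ, hσD, hσε⟩ := hq
  have hx : γ 1 = (fun s => σ (1 - s)) 0 := by simp [hγ.target, hσ.target]
  refine ⟨concat γ (fun s => σ (1 - s)), hγ.concat hσ.reverse, ?_, fun t ht => ?_⟩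
  · rw [two_mul, ENNReal.ofReal_add hD hD]
    refine (curveDiam_concat_le m hx).trans (add_le_add hγD ?_)
    refine (curveDiam_reverse_le m σ 0 1).trans ?_
    simpa using hσD
  · rcases le_total t (1 / 2) with h | h
    · have h2 : curveDiam m (concat γ fun s => σ (1 - s)) 0 t ≤ curveDiam m γ 0 (2 * t) :=
        curveDiam_le_of_forall_exists fun s hs => ⟨2 * s, ⟨by linarith [hs.1], by linarith [hs.2]⟩,
          concat_of_le _ _ (by linarith [hs.2])⟩
      rw [concat_of_le _ _ h]
      refine (ccBall_mono ?_).trans (hγε (2 * t) ⟨by linarith [ht.1], by linarith⟩)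
      gcongr
      exact (min_le_left _ _).trans h2
    · have h2 : curveDiam m (concat γ fun s => σ (1 - s)) t 1 ≤ curveDiam m σ 0 (2 - 2 * t) :=
        curveDiam_le_of_forall_exists fun s hs =>
          ⟨1 - (2 * s - 1), ⟨by linarith [hs.2], by linarith [hs.1]⟩,
            concat_of_ge hx (by linarith [hs.1])⟩
      rw [concat_of_ge hx h]
      have e : 1 - (2 * t - 1) = 2 - 2 * t := by ring
      rw [e]
      refine (ccBall_mono ?_).trans (hσε (2 - 2 * t) ⟨by linarith [ht.2], by linarith⟩)
      gcongr
      exact (min_le_right _ _).trans h2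

/-- A uniform arc that ends well inside `Ω` is a John arc. -/
lemma UniformArc.johnArc {m : ℕ} {Ω : Set (ℂ × ℝ)} {ε ε' D η : ℝ} {p x : ℂ × ℝ}
    (h : UniformArc m Ω ε D p x)
    (hx : ∀ y, ccDist m y x < ENNReal.ofReal η → ccBall m y (ENNReal.ofReal η) ⊆ Ω)
    (hε' : 0 ≤ ε') (hε : ε' ≤ ε) (h1 : ε' * D ≤ η) (h2 : ε' * D ≤ ε * η) :
    JohnArc m Ω ε' D p x := by
  obtain ⟨γ, hγ, hγD, hγε⟩ := h
  refine ⟨γ, hγ, hγD, fun t ht => ?_⟩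
  have ht0 : curveDiam m γ 0 t ≤ ENNReal.ofReal D :=
    (curveDiam_mono (Icc_subset_Icc_right ht.2)).trans hγD
  have hb : ENNReal.ofReal ε' * curveDiam m γ 0 t ≤ ENNReal.ofReal (ε' * D) := by
    rw [ENNReal.ofReal_mul hε']; gcongr
  by_cases hlt : ccDist m (γ t) x < ENNReal.ofReal η
  · exact (ccBall_mono (hb.trans (ENNReal.ofReal_le_ofReal h1))).trans (hx _ hlt)
  · refine (ccBall_mono ?_).trans (hγε t ht)
    rw [mul_min]
    refine le_min (by gcongr) ?_
    have h3 : ENNReal.ofReal η ≤ curveDiam m γ t 1 := by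
      refine (not_lt.1 hlt).trans ?_
      rw [← hγ.target]
      exact ccDist_le_curveDiam ⟨le_rfl, ht.2⟩ ⟨ht.2, le_rfl⟩
    calc _ ≤ ENNReal.ofReal (ε * η) := hb.trans (ENNReal.ofReal_le_ofReal h2)
      _ = ENNReal.ofReal ε * ENNReal.ofReal η := ENNReal.ofReal_mul (hε'.trans hε)
      _ ≤ _ := by gcongr

/-! ### Local models of a domain and their uniform arcs -/

/-- The decrease `s |G(p)| + σ² M Λ` at scale `s` and at the point `p` of the affine part of a local
model, where `Λ` is the vertical size of boxes. -/
noncomputable def slack (m : ℕ) (M σ : ℝ) (G : ℂ × ℝ → ℂ) (p : ℂ × ℝ) (s : ℝ) : ℝ :=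
  s * ‖G p‖ + σ ^ 2 * M * vsize m p.1 s

/-- In the frame based at any point `p ∈ V`, and at all scales `s ≤ s₀`, the set `Ω` is the sublevel
set `{F < 0}` of a function that is affine up to an error which is small when compared with the
decrease `slack` of its affine part `F(p) + ⟨G(p), w⟩ + σ c` at that scale. The number `σ` is `1`,
`-1` or `0`. -/
structure LocalModel (m : ℕ) (Ω V : Set (ℂ × ℝ)) (s₀ M σ : ℝ) (F : ℂ × ℝ → ℝ)
    (G : ℂ × ℝ → ℂ) : Prop where
  scale_pos : 0 < s₀
  one_le : 1 ≤ M
  abs_eq : |σ| = σ ^ 2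
  mem_iff : ∀ p ∈ V, ∀ s, 0 ≤ s → s ≤ s₀ → ∀ w c, ‖w‖ ≤ 3 * s → |c| ≤ 4 * M * vsize m p.1 s →
    (pt m p w c ∈ Ω ↔ F (pt m p w c) < 0)
  approx : ∀ p ∈ V, ∀ s, 0 ≤ s → s ≤ s₀ → ∀ w c, ‖w‖ ≤ 3 * s → |c| ≤ 4 * M * vsize m p.1 s →
    |F (pt m p w c) - F p - inner ℝ (G p) w - σ * c| ≤ 1 / 100 * slack m M σ G p s

/-- A constant, depending only on `m`, that bounds the effect of a change of base point. -/
noncomputable def kap (m : ℕ) : ℝ := (2 * m + 1) * 3 ^ (2 * m + 1)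

lemma three_le_kap (m : ℕ) : 3 ≤ kap m := by
  unfold kap
  have h1 : (1 : ℝ) ≤ 3 ^ (2 * m) := one_le_pow₀ (by norm_num)
  have h2 : (0 : ℝ) ≤ m := Nat.cast_nonneg m
  rw [pow_succ]
  nlinarith [mul_nonneg h2 (zero_le_one.trans h1)]

/-- The error made when the base point is moved by `w`, for `‖w‖ ≤ 2R` and a displacement of size
`δ R`. -/
lemma abs_lin_add_sub_le_kap {m : ℕ} {z w w' : ℂ} {R δ : ℝ} (hR : 0 ≤ R) (hw : ‖w‖ ≤ 2 * R)
    (hw' : ‖w'‖ ≤ δ * R) :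
    |lin m (z + w) w' - lin m z w'| ≤ (2 / 3) * δ * kap m * vsize m z R := by
  refine (abs_lin_sub_lin_le (ρ := ‖z‖ + 2 * R) (by linarith)
    ((norm_add_le _ _).trans (by linarith)) _).trans ?_
  rw [add_sub_cancel_left]
  have h : (‖z‖ + 2 * R) ^ (2 * m) ≤ 3 ^ (2 * m) * (‖z‖ + R) ^ (2 * m) := by
    rw [← mul_pow]
    have := norm_nonneg z
    gcongr
    linarith
  calc _ ≤ (2 * m + 1) * (3 ^ (2 * m) * (‖z‖ + R) ^ (2 * m)) * (2 * R) * (δ * R) := by gcongr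
    _ = _ := by unfold kap vsize; ring

lemma abs_lin_add_sub_le_of_small {m : ℕ} {z w w' : ℂ} {R δ : ℝ} (hR : 0 ≤ R) (hδ : 0 ≤ δ)
    (hδ1 : δ ≤ 1) (hw : ‖w‖ ≤ δ * R) (hw' : ‖w'‖ ≤ R) :
    |lin m (z + w) w' - lin m z w'| ≤ δ * kap m * vsize m z R := by
  have hwR : ‖w‖ ≤ R := hw.trans (mul_le_of_le_one_left hR hδ1)
  have h := abs_lin_sub_lin_le (m := m) (z := z) (z' := z + w) (ρ := ‖z‖ + R)
    (by linarith) ((norm_add_le _ _).trans (by linarith)) w'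
  rw [add_sub_cancel_left] at h
  have h3 : (1 : ℝ) ≤ 3 ^ (2 * m + 1) := one_le_pow₀ (by norm_num)
  calc _ ≤ _ := h
    _ ≤ (2 * m + 1) * (‖z‖ + R) ^ (2 * m) * (δ * R) * R := by gcongr
    _ = δ * ((2 * m + 1) * 1) * vsize m z R := by unfold vsize; ring
    _ ≤ δ * kap m * vsize m z R := by
      have := vsize_nonneg m z R
      unfold kap
      gcongr

lemma vsize_add_le_kap {m : ℕ} {z w : ℂ} {R δ : ℝ} (hR : 0 ≤ R) (hw : ‖w‖ ≤ 2 * R)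
    (hδ : 0 ≤ δ) (hδ1 : δ ≤ 1) : vsize m (z + w) (δ * R) ≤ (1 / 3) * δ * kap m * vsize m z R := by
  have h1 : δ * R ≤ R := mul_le_of_le_one_left hR hδ1
  have h : (‖z + w‖ + δ * R) ^ (2 * m) ≤ 3 ^ (2 * m) * (‖z‖ + R) ^ (2 * m) := by
    rw [← mul_pow]
    have := norm_nonneg z
    have := norm_add_le z w
    gcongr
    linarith
  have h2 : (1 : ℝ) ≤ 2 * m + 1 := by
    have : (0 : ℝ) ≤ m := Nat.cast_nonneg m
    linarith
  unfold vsize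
  calc _ ≤ (δ * R) ^ 2 * (3 ^ (2 * m) * (‖z‖ + R) ^ (2 * m)) := by gcongr
    _ = 1 * δ * (δ * (3 ^ (2 * m) * (R ^ 2 * (‖z‖ + R) ^ (2 * m)))) := by ring
    _ ≤ (2 * m + 1) * δ * (1 * (3 ^ (2 * m) * (R ^ 2 * (‖z‖ + R) ^ (2 * m)))) := by gcongr
    _ = _ := by unfold kap; ring

/-- Boxes with close centers and the same radius have vertical sizes within a factor `2`. -/
lemma vsize_le_two_mul {m : ℕ} {z z' : ℂ} {R : ℝ} (hR : 0 ≤ R)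
    (h : ‖z' - z‖ ≤ R / (100 * kap m)) : vsize m z' R ≤ 2 * vsize m z R := by
  have hk := three_le_kap m
  set a : ℝ := 1 / (100 * kap m) with ha
  have ha0 : 0 ≤ a := by positivity
  have h1 : ‖z'‖ + R ≤ (1 + a) * (‖z‖ + R) := by
    have h2 : ‖z'‖ ≤ ‖z‖ + ‖z' - z‖ := by simpa using norm_add_le z (z' - z)
    have h3 : R / (100 * kap m) = a * R := by rw [ha]; ring
    have := mul_nonneg ha0 (norm_nonneg z)
    rw [h3] at h
    linarith
  have h2 : (1 + a) ^ (2 * m) ≤ 2 := by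
    have hma : (2 * m : ℕ) * a ≤ 1 / 100 := by
      rw [ha, mul_one_div, div_le_iff₀ (by positivity)]
      have h3 : (1 : ℝ) ≤ 3 ^ (2 * m + 1) := one_le_pow₀ (by norm_num)
      have h2 : (0 : ℝ) ≤ m := Nat.cast_nonneg m
      unfold kap
      push_cast
      nlinarith
    calc (1 + a) ^ (2 * m) ≤ Real.exp a ^ (2 * m) := by
          gcongr
          rw [add_comm]; exact Real.add_one_le_exp a
      _ = Real.exp ((2 * m : ℕ) * a) := by rw [← Real.exp_nat_mul]
      _ ≤ Real.exp (1 / 100) := Real.exp_le_exp.2 hma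
      _ ≤ 1 / (1 - 1 / 100) := Real.exp_bound_div_one_sub_of_interval (by norm_num) (by norm_num)
      _ ≤ 2 := by norm_num
  unfold vsize
  calc _ ≤ R ^ 2 * ((1 + a) * (‖z‖ + R)) ^ (2 * m) := by gcongr
    _ = (1 + a) ^ (2 * m) * (R ^ 2 * (‖z‖ + R) ^ (2 * m)) := by rw [mul_pow]; ring
    _ ≤ _ := by gcongr

/-- The direction of `G(p)`. -/
noncomputable def dir (G : ℂ × ℝ → ℂ) (p : ℂ × ℝ) : ℂ := (‖G p‖⁻¹ : ℝ) • G p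

lemma norm_dir_le (G : ℂ × ℝ → ℂ) (p : ℂ × ℝ) : ‖dir G p‖ ≤ 1 := by
  rw [dir, norm_smul, norm_inv, norm_norm]
  exact inv_mul_le_one

lemma inner_dir (G : ℂ × ℝ → ℂ) (p : ℂ × ℝ) : inner ℝ (G p) (dir G p) = ‖G p‖ := by
  rw [dir, inner_smul_right, real_inner_self_eq_norm_sq]
  by_cases h : ‖G p‖ = 0
  · simp [h]
  · field_simp

/-- The point at scale `s` of the curve that leaves `p` in the direction in which the affine part
of a local model decreases. -/
noncomputable def descent (m : ℕ) (M σ : ℝ) (G : ℂ × ℝ → ℂ) (p : ℂ × ℝ) (s : ℝ) : ℂ × ℝ :=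
  pt m p (-s • dir G p) (-(σ * M * vsize m p.1 s))

lemma norm_neg_smul_dir_le (G : ℂ × ℝ → ℂ) (p : ℂ × ℝ) {s : ℝ} (hs : 0 ≤ s) :
    ‖-s • dir G p‖ ≤ s := by
  rw [norm_smul, norm_neg, Real.norm_eq_abs, abs_of_nonneg hs]
  exact mul_le_of_le_one_right hs (norm_dir_le G p)

namespace LocalModel

variable {m : ℕ} {Ω V : Set (ℂ × ℝ)} {s₀ M σ : ℝ} {F : ℂ × ℝ → ℝ} {G : ℂ × ℝ → ℂ}

lemma slack_nonneg (H : LocalModel m Ω V s₀ M σ F G) (p : ℂ × ℝ) {s : ℝ} (hs : 0 ≤ s) :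
    0 ≤ slack m M σ G p s := by
  have := H.one_le
  have := vsize_nonneg m p.1 s
  unfold slack
  positivity

lemma sq_le_one (H : LocalModel m Ω V s₀ M σ F G) : σ ^ 2 ≤ 1 := by
  have h := H.abs_eq
  rcases (abs_nonneg σ).eq_or_lt with h0 | h0
  · rw [← h, ← h0]; exact zero_le_one
  · have h2 : |σ| * |σ| = |σ| * 1 := by rw [← sq, sq_abs, h, mul_one]
    rw [← h, mul_left_cancel₀ h0.ne' h2]

lemma abs_mul_le (H : LocalModel m Ω V s₀ M σ F G) {x B : ℝ} (hx : |x| ≤ B) :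
    |σ * x| ≤ σ ^ 2 * B := by
  rw [abs_mul, H.abs_eq]
  gcongr

lemma neg_of_mem (H : LocalModel m Ω V s₀ M σ F G) {p : ℂ × ℝ} (hp : p ∈ V) (hpΩ : p ∈ Ω) :
    F p < 0 := by
  have h := H.mem_iff p hp 0 le_rfl H.scale_pos.le 0 0 (by simp) (by simp [vsize_zero])
  rw [pt_zero] at h
  exact h.1 hpΩ

lemma abs_descent_height_le (H : LocalModel m Ω V s₀ M σ F G) (p : ℂ × ℝ) (s : ℝ) :
    |-(σ * M * vsize m p.1 s)| ≤ M * vsize m p.1 s := by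
  have h := vsize_nonneg m p.1 s
  have hM := H.one_le
  rw [abs_neg, mul_assoc, abs_mul, H.abs_eq, abs_of_nonneg (by positivity)]
  exact mul_le_of_le_one_left (by positivity) H.sq_le_one

/-- At points where the affine part is at most `-slack/4`, the set `Ω` contains a box whose radius
is comparable with the scale. -/
lemma mem_of_inBox (H : LocalModel m Ω V s₀ M σ F G) {p y : ℂ × ℝ} (hp : p ∈ V) {R c : ℝ} {w : ℂ}
    (hR : 0 ≤ R) (hRs : R ≤ s₀) (hw : ‖w‖ ≤ 2 * R) (hc : |c| ≤ 3 * M * vsize m p.1 R)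
    (hF : F p + inner ℝ (G p) w + σ * c < -(slack m M σ G p R / 4))
    (hy : InBox m (1 / (10 * kap m) * R) (pt m p w c) y) : y ∈ Ω := by
  have hk := three_le_kap m
  have hM := H.one_le
  have hv := vsize_nonneg m p.1 R
  set δ : ℝ := 1 / (10 * kap m) with hδ
  have hδk : δ * kap m = 1 / 10 := by rw [hδ]; field_simp
  have hδ0 : 0 ≤ δ := by positivity
  have hδ1 : δ ≤ 1 / 10 := by nlinarith
  obtain ⟨w', c', rfl⟩ : ∃ w' c', pt m (pt m p w c) w' c' = y := ⟨_, _, pt_coords m _ y⟩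
  rw [inBox_pt] at hy
  obtain ⟨hw', hc'⟩ := hy
  rw [pt_pt]
  set e := lin m (p.1 + w) w' - lin m p.1 w' with he
  have he' : |e| ≤ (2 / 3) * δ * kap m * vsize m p.1 R := abs_lin_add_sub_le_kap hR hw hw'
  have hc'' : |c'| ≤ (1 / 3) * δ * kap m * vsize m p.1 R :=
    hc'.trans (vsize_add_le_kap hR hw hδ0 (by linarith))
  have hce : |c' + e| ≤ 1 / 10 * vsize m p.1 R := by
    refine (abs_add_le _ _).trans ?_
    calc _ ≤ δ * kap m * vsize m p.1 R := by linarith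
      _ = _ := by rw [hδk]
  have hww : ‖w + w'‖ ≤ 3 * R := (norm_add_le _ _).trans (by nlinarith)
  have hcc : |c + (c' + e)| ≤ 4 * M * vsize m p.1 R := (abs_add_le _ _).trans (by nlinarith)
  rw [H.mem_iff p hp R hR hRs _ _ hww hcc]
  have ha := (abs_le.1 (H.approx p hp R hR hRs _ _ hww hcc)).2
  have hσ := (abs_le.1 (H.abs_mul_le hce)).2
  have hin : inner ℝ (G p) w' ≤ 1 / 10 * (R * ‖G p‖) := by
    refine (real_inner_le_norm _ _).trans ?_
    calc _ ≤ ‖G p‖ * (δ * R) := by gcongr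
      _ ≤ ‖G p‖ * (1 / 10 * R) := by gcongr
      _ = _ := by ring
  rw [inner_add_right, mul_add] at ha
  have hsl : 1 / 10 * (R * ‖G p‖) + σ ^ 2 * (1 / 10 * vsize m p.1 R) ≤
      1 / 10 * slack m M σ G p R := by
    unfold slack
    have : σ ^ 2 * vsize m p.1 R ≤ σ ^ 2 * vsize m p.1 R * M :=
      le_mul_of_one_le_right (by positivity) hM
    linarith
  have h0 := H.slack_nonneg p hR
  linarith

lemma affine_descent (p : ℂ × ℝ) (s : ℝ) :
    inner ℝ (G p) (-s • dir G p) + σ * -(σ * M * vsize m p.1 s) = -slack m M σ G p s := by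
  rw [inner_smul_right, inner_dir, slack]; ring

/-- The slack varies slowly with the point. -/
lemma slack_le (H : LocalModel m Ω V s₀ M σ F G) {p q : ℂ × ℝ} (hp : p ∈ V) (hq : q ∈ V) {R : ℝ}
    (hR : 0 ≤ R) (hRs : R ≤ s₀) (hpq : InBox m (R / (100 * kap m)) p q) :
    slack m M σ G p R ≤ 3 * slack m M σ G q R := by
  have hk := three_le_kap m
  have hM := H.one_le
  set δ : ℝ := 1 / (100 * kap m) with hδ
  have hδk : δ * kap m = 1 / 100 := by rw [hδ]; field_simp
  have hδ0 : 0 ≤ δ := by positivity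
  have hδ1 : δ ≤ 1 / 100 := by nlinarith
  have hRδ : R / (100 * kap m) = δ * R := by rw [hδ]; ring
  have hvp := vsize_nonneg m p.1 R
  have hvq : vsize m p.1 R ≤ 2 * vsize m q.1 R :=
    vsize_le_two_mul hR (by rw [norm_sub_rev]; exact hpq.1)
  obtain ⟨w, c, rfl⟩ : ∃ w c, pt m p w c = q := ⟨_, _, pt_coords m _ q⟩
  rw [inBox_pt, hRδ] at hpq
  obtain ⟨hw, hc⟩ := hpq
  have hwR : ‖w‖ ≤ R := hw.trans (by nlinarith)
  have hc' : |c| ≤ 1 / 100 * vsize m p.1 R :=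
    (hc.trans (vsize_mul_le m _ hR hδ0 (by linarith))).trans (by gcongr)
  set q := pt m p w c with hqdef
  set u : ℂ := -R • dir G p with hu
  have hun : ‖u‖ ≤ R := norm_neg_smul_dir_le G p hR
  -- Compare the two affine approximations, based at `p` and at `q`, at the point `q + u`.
  set e := lin m (p.1 + w) u - lin m p.1 u with he
  have hx : pt m q u 0 = pt m p (w + u) (c + (0 + e)) := pt_pt m p w u c 0
  have he' : |e| ≤ 1 / 100 * vsize m p.1 R := by
    refine (abs_lin_add_sub_le_of_small hR hδ0 (by linarith) hw hun).trans ?_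
    rw [hδk]
  have hvle : vsize m p.1 R ≤ M * vsize m p.1 R := le_mul_of_one_le_left hvp hM
  have a1 := H.approx q hq R hR hRs u 0 (by linarith)
    (by rw [abs_zero]; have := vsize_nonneg m q.1 R; positivity)
  have a2 := H.approx p hp R hR hRs (w + u) (c + (0 + e))
    ((norm_add_le _ _).trans (by linarith))
    ((abs_add_le _ _).trans (by rw [zero_add]; nlinarith))
  have a3 := H.approx p hp R hR hRs w c (by linarith) (by nlinarith)
  rw [← hx] at a2
  rw [← hqdef] at a3
  rw [zero_add, inner_add_right, mul_add] at a2
  rw [mul_zero, sub_zero] at a1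
  have b1 := (abs_le.1 a1).1
  have b2 := (abs_le.1 a2).2
  have b3 := (abs_le.1 a3).1
  have i1 : inner ℝ (G p) u = -(R * ‖G p‖) := by
    rw [hu, inner_smul_right, inner_dir]; ring
  have i2 : -(R * ‖G q‖) ≤ inner ℝ (G q) u := by
    have h1 := (abs_le.1 (abs_real_inner_le_norm (G q) u)).1
    have h2 : ‖G q‖ * ‖u‖ ≤ ‖G q‖ * R := by gcongr
    linarith
  have s1 := (abs_le.1 (H.abs_mul_le he')).2
  have hs : σ ^ 2 * (1 / 100 * vsize m p.1 R) ≤ 1 / 100 * slack m M σ G p R := by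
    have h1 : σ ^ 2 * vsize m p.1 R ≤ σ ^ 2 * (M * vsize m p.1 R) := by gcongr
    have h2 : 0 ≤ R * ‖G p‖ := by positivity
    unfold slack
    linarith
  have hsl : slack m M σ G p R ≤ R * ‖G p‖ + 2 * (σ ^ 2 * M * vsize m q.1 R) := by
    have h1 : σ ^ 2 * M * vsize m p.1 R ≤ σ ^ 2 * M * (2 * vsize m q.1 R) := by gcongr
    unfold slack
    linarith
  have hq0 : 0 ≤ R * ‖G q‖ := by positivity
  have hqe : slack m M σ G q R = R * ‖G q‖ + σ ^ 2 * M * vsize m q.1 R := rfl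
  have h0 := H.slack_nonneg p hR
  have h0q := H.slack_nonneg q hR
  linarith

/-- In the coordinates based at `p`, the descent point of a close point `q` has a very negative
affine part. -/
lemma exists_descent_eq (H : LocalModel m Ω V s₀ M σ F G) {p q : ℂ × ℝ} (hp : p ∈ V) (hq : q ∈ V)
    (hqΩ : q ∈ Ω) {R : ℝ} (hR : 0 ≤ R) (hRs : R ≤ s₀)
    (hpq : InBox m (R / (100 * kap m)) p q) :
    ∃ w c, descent m M σ G q R = pt m p w c ∧ ‖w‖ ≤ 2 * R ∧ |c| ≤ 3 * M * vsize m p.1 R ∧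
      F p + inner ℝ (G p) w + σ * c < -(slack m M σ G p R / 4) := by
  have hk := three_le_kap m
  have hM := H.one_le
  have hsl := H.slack_le hp hq hR hRs hpq
  set δ : ℝ := 1 / (100 * kap m) with hδ
  have hδk : δ * kap m = 1 / 100 := by rw [hδ]; field_simp
  have hδ0 : 0 ≤ δ := by positivity
  have hδ1 : δ ≤ 1 / 100 := by nlinarith
  have hRδ : R / (100 * kap m) = δ * R := by rw [hδ]; ring
  have hvp := vsize_nonneg m p.1 R
  have hvq : vsize m q.1 R ≤ 2 * vsize m p.1 R := vsize_le_two_mul hR hpq.1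
  obtain ⟨w, c, rfl⟩ : ∃ w c, pt m p w c = q := ⟨_, _, pt_coords m _ q⟩
  rw [inBox_pt, hRδ] at hpq
  obtain ⟨hw, hc⟩ := hpq
  have hwR : ‖w‖ ≤ R := hw.trans (by nlinarith)
  have hc' : |c| ≤ 1 / 100 * vsize m p.1 R :=
    (hc.trans (vsize_mul_le m _ hR hδ0 (by linarith))).trans (by gcongr)
  set q := pt m p w c with hqdef
  set u : ℂ := -R • dir G q with hu
  have hun : ‖u‖ ≤ R := norm_neg_smul_dir_le G q hR
  set d : ℝ := -(σ * M * vsize m q.1 R) with hd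
  have hdn : |d| ≤ M * vsize m q.1 R := H.abs_descent_height_le q R
  set e := lin m (p.1 + w) u - lin m p.1 u with he
  have hx : pt m q u d = pt m p (w + u) (c + (d + e)) := pt_pt m p w u c d
  have he' : |e| ≤ 1 / 100 * vsize m p.1 R := by
    refine (abs_lin_add_sub_le_of_small hR hδ0 (by linarith) hw hun).trans ?_
    rw [hδk]
  have hvle : vsize m p.1 R ≤ M * vsize m p.1 R := le_mul_of_one_le_left hvp hM
  have hdle : M * vsize m q.1 R ≤ 2 * (M * vsize m p.1 R) := by
    calc _ ≤ M * (2 * vsize m p.1 R) := by gcongr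
      _ = _ := by ring
  have hwu : ‖w + u‖ ≤ 2 * R := (norm_add_le _ _).trans (by linarith)
  have hcd : |c + (d + e)| ≤ 3 * M * vsize m p.1 R := by
    have h1 := abs_add_le c (d + e)
    have h2 := abs_add_le d e
    linarith
  refine ⟨w + u, c + (d + e), hx, hwu, hcd, ?_⟩
  have a1 := H.approx q hq R hR hRs u d (by linarith) (by
    have := vsize_nonneg m q.1 R
    have : 0 ≤ M * vsize m q.1 R := by positivity
    linarith)
  have a2 := H.approx p hp R hR hRs (w + u) (c + (d + e)) (by linarith) (by
    have : 0 ≤ M * vsize m p.1 R := by positivity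
    linarith)
  rw [← hx] at a2
  have b1 := (abs_le.1 a1).2
  have b2 := (abs_le.1 a2).1
  have haff : inner ℝ (G q) u + σ * d = -slack m M σ G q R := affine_descent q R
  have hFq := H.neg_of_mem hq hqΩ
  have h0 := H.slack_nonneg p hR
  have h0q := H.slack_nonneg q hR
  linarith

/-- The ratio between the diameter of the curves constructed at some scale and that scale. -/
noncomputable def diamConst (m : ℕ) (M : ℝ) : ℝ := (36 * m + 19) * ((6 * M + 4 * m + 2) * 4)

lemma ccDist_pt_pt_le {M : ℝ} (hM : 1 ≤ M) {p : ℂ × ℝ} {s c c' : ℝ} {w w' : ℂ} (hs : 0 ≤ s)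
    (hw : ‖w‖ ≤ 2 * s) (hw' : ‖w'‖ ≤ 2 * s) (hc : |c| ≤ 3 * M * vsize m p.1 s)
    (hc' : |c'| ≤ 3 * M * vsize m p.1 s) :
    ccDist m (pt m p w c) (pt m p w' c') ≤ ENNReal.ofReal (diamConst m M * s) := by
  rcases hs.eq_or_lt with rfl | hs
  · rw [mul_zero, norm_le_zero_iff] at hw hw'
    rw [vsize_zero, mul_zero, abs_nonpos_iff] at hc hc'
    rw [hw, hw', hc, hc', ccDist_self]
    exact zero_le
  · have hv : vsize m p.1 s ≤ vsize m p.1 (2 * s) := vsize_mono m _ hs.le (by linarith)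
    have hB : 3 * M * vsize m p.1 s ≤ 3 * M * vsize m p.1 (2 * s) := by gcongr
    have h := inBox_pt_pt (B := 3 * M) (by positivity) hw hw' (hc.trans hB) (hc'.trans hB)
    refine (ccDist_le_of_inBox (by positivity) h).trans (le_of_eq ?_)
    unfold diamConst
    congr 1; ring

lemma ccBall_subset (H : LocalModel m Ω V s₀ M σ F G) {p : ℂ × ℝ} (hp : p ∈ V) {R c ρ : ℝ} {w : ℂ}
    (hR : 0 ≤ R) (hRs : R ≤ s₀) (hw : ‖w‖ ≤ 2 * R) (hc : |c| ≤ 3 * M * vsize m p.1 R)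
    (hF : F p + inner ℝ (G p) w + σ * c < -(slack m M σ G p R / 4))
    (hρ : (2 * m + 1) * ρ ≤ 1 / (10 * kap m) * R) (hρ0 : 0 ≤ ρ) :
    ccBall m (pt m p w c) (ENNReal.ofReal ρ) ⊆ Ω :=
  ccBall_subset_of_forall_inBox fun _ hq =>
    H.mem_of_inBox hp hR hRs hw hc hF (hq.mono (by positivity) hρ)

lemma continuous_pt (m : ℕ) (p : ℂ × ℝ) {w : ℝ → ℂ} {c : ℝ → ℝ} (hw : Continuous w)
    (hc : Continuous c) : Continuous fun s => pt m p (w s) (c s) := by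
  unfold pt
  fun_prop

/-- The constant in the bound from below of the distance to the complement. -/
noncomputable def depthConst (m : ℕ) (M : ℝ) : ℝ :=
  1 / (10 * kap m) / ((2 * m + 1) * (2 * diamConst m M))

lemma diamConst_pos (m : ℕ) {M : ℝ} (hM : 1 ≤ M) : 0 < diamConst m M := by
  unfold diamConst; positivity

lemma depthConst_pos (m : ℕ) {M : ℝ} (hM : 1 ≤ M) : 0 < depthConst m M := by
  have := diamConst_pos m hM
  have := three_le_kap m
  unfold depthConst; positivity

lemma depthConst_mul (m : ℕ) {M : ℝ} (hM : 1 ≤ M) (R : ℝ) :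
    (2 * m + 1) * (depthConst m M * (2 * diamConst m M * R)) = 1 / (10 * kap m) * R := by
  have := diamConst_pos m hM
  have := three_le_kap m
  unfold depthConst; field_simp

lemma johnArc_descent (H : LocalModel m Ω V s₀ M σ F G) {p : ℂ × ℝ} (hp : p ∈ V) (hpΩ : p ∈ Ω)
    {R : ℝ} (hR : 0 ≤ R) (hRs : R ≤ s₀) :
    JohnArc m Ω (depthConst m M) (diamConst m M * R) p (descent m M σ G p R) := by
  have hM := H.one_le
  have hd := diamConst_pos m hM
  have he := depthConst_pos m hM
  have hk := three_le_kap m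
  have hFp := H.neg_of_mem hp hpΩ
  have hdiam : ∀ t ∈ Icc (0 : ℝ) 1, curveDiam m (fun s => descent m M σ G p (s * R)) 0 t ≤
      ENNReal.ofReal (diamConst m M * (t * R)) := fun t ht => by
    have ht0 : 0 ≤ t * R := mul_nonneg ht.1 hR
    refine curveDiam_le fun s hs s' hs' => ?_
    have key : ∀ s ∈ Icc (0 : ℝ) t, ‖-(s * R) • dir G p‖ ≤ 2 * (t * R) ∧
        |-(σ * M * vsize m p.1 (s * R))| ≤ 3 * M * vsize m p.1 (t * R) := fun s hs => by
      have hs0 : 0 ≤ s * R := mul_nonneg hs.1 hR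
      have hst : s * R ≤ t * R := by gcongr; exact hs.2
      have hv := vsize_mono m p.1 hs0 hst
      have hv0 := vsize_nonneg m p.1 (t * R)
      refine ⟨(norm_neg_smul_dir_le G p hs0).trans (by linarith),
        (H.abs_descent_height_le p _).trans ?_⟩
      calc _ ≤ M * vsize m p.1 (t * R) := by gcongr
        _ ≤ _ := by gcongr; linarith
    exact ccDist_pt_pt_le hM ht0 (key s hs).1 (key s' hs').1 (key s hs).2 (key s' hs').2
  have hball : ∀ t ∈ Icc (0 : ℝ) 1, ∀ ρ, 0 ≤ ρ →
      (2 * m + 1) * ρ ≤ 1 / (10 * kap m) * (t * R) →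
      ccBall m (descent m M σ G p (t * R)) (ENNReal.ofReal ρ) ⊆ Ω := fun t ht ρ hρ0 hρ => by
    have ht0 : 0 ≤ t * R := mul_nonneg ht.1 hR
    have hv0 := vsize_nonneg m p.1 (t * R)
    have hs0 := H.slack_nonneg p ht0
    refine H.ccBall_subset hp ht0 ((mul_le_of_le_one_left hR ht.2).trans hRs)
      ((norm_neg_smul_dir_le G p ht0).trans (by linarith))
      ((H.abs_descent_height_le p _).trans (by gcongr; linarith)) ?_ hρ hρ0
    rw [add_assoc, affine_descent]
    linarith
  have hmaps : ∀ t ∈ Icc (0 : ℝ) 1, descent m M σ G p (t * R) ∈ Ω := fun t ht => by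
    have ht0 : 0 ≤ t * R := mul_nonneg ht.1 hR
    have hv0 := vsize_nonneg m p.1 (t * R)
    have hs0 := H.slack_nonneg p ht0
    refine H.mem_of_inBox hp ht0 ((mul_le_of_le_one_left hR ht.2).trans hRs)
      ((norm_neg_smul_dir_le G p ht0).trans (by linarith))
      ((H.abs_descent_height_le p _).trans (by gcongr; linarith)) ?_
      (y := descent m M σ G p (t * R)) ?_
    · rw [add_assoc, affine_descent]
      linarith
    · exact inBox_self m _ (by positivity)
  refine ⟨fun s => descent m M σ G p (s * R), ⟨?_, hmaps, ?_, by simp⟩, ?_, fun t ht => ?_⟩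
  · refine (continuous_pt m p (by fun_prop) ?_).continuousOn
    unfold vsize
    fun_prop
  · simp [descent, vsize_zero, pt_zero]
  · simpa using hdiam 1 ⟨zero_le_one, le_rfl⟩
  · have ht0 : 0 ≤ t * R := mul_nonneg ht.1 hR
    refine (ccBall_mono (mul_le_mul_right (hdiam t ht) _)).trans ?_
    rw [← ENNReal.ofReal_mul he.le]
    refine hball t ht _ (by positivity) ?_
    rw [← depthConst_mul m hM]
    gcongr
    linarith

/-- Close points of a local model are joined by uniform arcs: two descent curves, whose ends are
linked by a segment in the coordinates based at one of the points. -/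
lemma uniformArc_of_inBox (H : LocalModel m Ω V s₀ M σ F G) {p q : ℂ × ℝ} (hp : p ∈ V)
    (hpΩ : p ∈ Ω) (hq : q ∈ V) (hqΩ : q ∈ Ω) {R : ℝ} (hR : 0 ≤ R) (hRs : R ≤ s₀)
    (hpq : InBox m (R / (100 * kap m)) p q) :
    UniformArc m Ω (depthConst m M) (2 * (2 * diamConst m M * R)) p q := by
  have hM := H.one_le
  have hd := diamConst_pos m hM
  have he := depthConst_pos m hM
  have hk := three_le_kap m
  have hFp := H.neg_of_mem hp hpΩ
  have hs0 := H.slack_nonneg p hR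
  have hv0 := vsize_nonneg m p.1 R
  obtain ⟨w, c, hwc, hw, hc, hF⟩ := H.exists_descent_eq hp hq hqΩ hR hRs hpq
  set w₀ : ℂ := -R • dir G p with hw₀
  set c₀ : ℝ := -(σ * M * vsize m p.1 R) with hc₀
  have hw₀n : ‖w₀‖ ≤ 2 * R := (norm_neg_smul_dir_le G p hR).trans (by linarith)
  have hc₀n : |c₀| ≤ 3 * M * vsize m p.1 R :=
    (H.abs_descent_height_le p _).trans (by gcongr; linarith)
  have hF₀ : F p + inner ℝ (G p) w₀ + σ * c₀ < -(slack m M σ G p R / 4) := by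
    rw [add_assoc, affine_descent]
    linarith
  let wt : ℝ → ℂ := fun t => (1 - t) • w₀ + t • w
  let ct : ℝ → ℝ := fun t => (1 - t) * c₀ + t * c
  have hwt : ∀ t ∈ Icc (0 : ℝ) 1, ‖wt t‖ ≤ 2 * R := fun t ht => by
    have h := convex_closedBall (0 : ℂ) (2 * R) (mem_closedBall_zero_iff.2 hw₀n)
      (mem_closedBall_zero_iff.2 hw) (sub_nonneg.2 ht.2) ht.1 (by ring)
    exact mem_closedBall_zero_iff.1 h
  have hct : ∀ t ∈ Icc (0 : ℝ) 1, |ct t| ≤ 3 * M * vsize m p.1 R := fun t ht => by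
    have h := convex_closedBall (0 : ℝ) (3 * M * vsize m p.1 R) (mem_closedBall_zero_iff.2 hc₀n)
      (mem_closedBall_zero_iff.2 hc) (sub_nonneg.2 ht.2) ht.1 (by ring)
    exact mem_closedBall_zero_iff.1 h
  have hFt : ∀ t ∈ Icc (0 : ℝ) 1,
      F p + inner ℝ (G p) (wt t) + σ * ct t < -(slack m M σ G p R / 4) := fun t ht => by
    have h := convex_Iio (-(slack m M σ G p R / 4)) hF₀ hF (sub_nonneg.2 ht.2) ht.1 (by ring)
    refine lt_of_eq_of_lt ?_ h
    simp only [wt, ct, inner_add_right, inner_smul_right, smul_eq_mul]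
    ring
  have hσD : curveDiam m (fun t => pt m p (wt t) (ct t)) 0 1 ≤
      ENNReal.ofReal (diamConst m M * R) :=
    curveDiam_le fun s hs s' hs' =>
      ccDist_pt_pt_le hM hR (hwt s hs) (hwt s' hs') (hct s hs) (hct s' hs')
  have hσ : IsCurveIn Ω (fun t => pt m p (wt t) (ct t)) (descent m M σ G p R)
      (descent m M σ G q R) := by
    refine ⟨(continuous_pt m p (by fun_prop) (by fun_prop)).continuousOn, fun t ht => ?_, ?_, ?_⟩
    · exact H.mem_of_inBox hp hR hRs (hwt t ht) (hct t ht) (hFt t ht)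
        (inBox_self m _ (by positivity))
    · simp [wt, ct, descent, hw₀, hc₀]
    · simp [wt, ct, hwc]
  have hσρ : ∀ t ∈ Icc (0 : ℝ) 1, ccBall m (pt m p (wt t) (ct t))
      (ENNReal.ofReal (depthConst m M * (2 * diamConst m M * R))) ⊆ Ω := fun t ht =>
    H.ccBall_subset hp hR hRs (hwt t ht) (hct t ht) (hFt t ht) (depthConst_mul m hM R).le
      (by positivity)
  have hp' := (H.johnArc_descent hp hpΩ hR hRs).trans_curve hσ hσD hσρ (by positivity)
    (by positivity) he.le le_rfl (le_of_eq (by ring))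
  have e2 : diamConst m M * R + diamConst m M * R = 2 * diamConst m M * R := by ring
  rw [e2] at hp'
  obtain ⟨γ, hγ, hγD, hγε⟩ := H.johnArc_descent hq hqΩ hR hRs
  exact hp'.uniformArc (by positivity) ⟨γ, hγ, hγD.trans (ENNReal.ofReal_le_ofReal (by
    have : 0 ≤ diamConst m M * R := by positivity
    linarith)), hγε⟩

end LocalModel

lemma uniformArc_refl {m : ℕ} {Ω : Set (ℂ × ℝ)} {p : ℂ × ℝ} (hp : p ∈ Ω) (ε D : ℝ) :
    UniformArc m Ω ε D p p := by
  have h0 : ∀ a b, curveDiam m (fun _ => p) a b = 0 := fun a b =>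
    le_antisymm (curveDiam_le fun _ _ _ _ => (ccDist_self m p).le) zero_le
  refine ⟨fun _ => p, ⟨continuousOn_const, fun _ _ => hp, rfl, rfl⟩, by rw [h0]; exact zero_le,
    fun t _ => ?_⟩
  rw [h0, h0, min_self, mul_zero]
  exact fun q hq => absurd (show ccDist m p q < 0 from hq) not_lt_zero

/-- Around the center of a local model, any two points of `Ω` are joined by a uniform arc. -/
lemma LocalModel.exists_nhds_uniformArc {m : ℕ} {Ω V : Set (ℂ × ℝ)} {s₀ M σ : ℝ} {F : ℂ × ℝ → ℝ}
    {G : ℂ × ℝ → ℂ} (H : LocalModel m Ω V s₀ M σ F G) {p₀ : ℂ × ℝ} (hV : V ∈ 𝓝 p₀) :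
    ∃ W ∈ 𝓝 p₀, ∃ ε > 0, ∃ K > 0, ∀ p ∈ W ∩ Ω, ∀ q ∈ W ∩ Ω,
      UniformArc m Ω ε (K * (ccDist m p q).toReal) p q := by
  have hM := H.one_le
  have hk := three_le_kap m
  have hd := LocalModel.diamConst_pos m hM
  set N : ℝ := 100 * kap m * ((2 * m + 1) * 2) with hN
  have hN0 : 0 < N := by positivity
  obtain ⟨W, hW, hWd⟩ := exists_nhds_ccDist_lt m p₀ (div_pos H.scale_pos hN0)
  refine ⟨V ∩ W, inter_mem hV hW, _, LocalModel.depthConst_pos m hM,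
    2 * (2 * LocalModel.diamConst m M * N), by positivity, ?_⟩
  rintro p ⟨⟨hpV, hpW⟩, hpΩ⟩ q ⟨⟨hqV, hqW⟩, hqΩ⟩
  by_cases hpq : p = q
  · subst hpq; exact uniformArc_refl hpΩ _ _
  set d : ℝ := (ccDist m p q).toReal with hdef
  have hdpos : 0 < d := ENNReal.toReal_pos (ccDist_pos m hpq).ne' (ccDist_ne_top m p q)
  have hde : ccDist m p q = ENNReal.ofReal d := (ENNReal.ofReal_toReal (ccDist_ne_top m p q)).symm
  have hdlt : d < s₀ / N := by
    have := hWd p hpW q hqW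
    rwa [hde, ENNReal.ofReal_lt_ofReal_iff (div_pos H.scale_pos hN0)] at this
  have hR : N * d ≤ s₀ := by
    rw [lt_div_iff₀ hN0] at hdlt; linarith
  have hbox : InBox m ((2 * m + 1) * (2 * d)) p q := inBox_of_ccDist_lt (by
    rw [hde, ENNReal.ofReal_lt_ofReal_iff (by positivity)]; linarith)
  have hRN : N * d / (100 * kap m) = (2 * m + 1) * (2 * d) := by rw [hN]; field_simp
  have := H.uniformArc_of_inBox hpV hpΩ hqV hqΩ (by positivity) hR (by rw [hRN]; exact hbox)
  convert this using 1
  ring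

/-! ### Local models at the points of the closure -/

/-- The first order Taylor estimate on a ball, for a derivative that is Lipschitz at `x`. -/
lemma norm_sub_sub_fderiv_le {E : Type*} [NormedAddCommGroup E] [NormedSpace ℝ E] {f : E → ℝ}
    {x₀ x y : E} {ρ K : ℝ} (hx : x ∈ Metric.ball x₀ ρ) (hy : y ∈ Metric.ball x₀ ρ)
    (hK : 0 ≤ K) (hf : ∀ u ∈ Metric.ball x₀ ρ, DifferentiableAt ℝ f u)
    (hL : ∀ u ∈ Metric.ball x₀ ρ, ‖u - x‖ ≤ ‖y - x‖ →
      ‖fderiv ℝ f u - fderiv ℝ f x‖ ≤ K * ‖u - x‖) :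
    |f y - f x - fderiv ℝ f x (y - x)| ≤ K * ‖y - x‖ ^ 2 := by
  have hconv : Convex ℝ (Metric.ball x₀ ρ ∩ Metric.closedBall x ‖y - x‖) :=
    (convex_ball _ _).inter (convex_closedBall _ _)
  have h := hconv.norm_image_sub_le_of_norm_fderiv_le' (f := f) (φ := fderiv ℝ f x)
    (C := K * ‖y - x‖) (fun u hu => hf u hu.1) (fun u hu => ?_)
    ⟨hx, Metric.mem_closedBall_self (norm_nonneg _)⟩ ⟨hy, by rw [mem_closedBall_iff_norm]⟩
  · rw [Real.norm_eq_abs] at h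
    exact h.trans (le_of_eq (by ring))
  · have hu2 := mem_closedBall_iff_norm.1 hu.2
    exact (hL u hu.1 hu2).trans (by gcongr)

/-- The vector that represents a linear form on the plane. -/
noncomputable def planeGrad (ℓ : ℂ →L[ℝ] ℝ) : ℂ := ⟨ℓ 1, ℓ Complex.I⟩

lemma clm_apply_eq (ℓ : ℂ →L[ℝ] ℝ) (w : ℂ) : ℓ w = w.re * ℓ 1 + w.im * ℓ Complex.I := by
  have h : w = w.re • (1 : ℂ) + w.im • Complex.I := by
    apply Complex.ext <;> simp
  conv_lhs => rw [h]
  simp only [map_add, map_smul, smul_eq_mul]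

lemma inner_planeGrad (ℓ : ℂ →L[ℝ] ℝ) (w : ℂ) : inner ℝ (planeGrad ℓ) w = ℓ w := by
  rw [clm_apply_eq, Complex.inner]
  simp [planeGrad]

/-- Small boxes in the frames based at points close to `p₀` are contained in a given neighborhood
of `p₀`. -/
lemma exists_nhds_pt_mem (m : ℕ) {p₀ : ℂ × ℝ} {W : Set (ℂ × ℝ)} (hW : W ∈ 𝓝 p₀) {M : ℝ}
    (hM : 1 ≤ M) : ∃ s₁ > 0, ∃ V ∈ 𝓝 p₀, ∀ p ∈ V, ∀ s, 0 ≤ s → s ≤ s₁ → ∀ w c, ‖w‖ ≤ 3 * s →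
      |c| ≤ 4 * M * vsize m p.1 s → pt m p w c ∈ W := by
  obtain ⟨η, hη, V, hV, h⟩ := exists_nhds_inBox_mem m hW
  refine ⟨η / (4 * M), by positivity, V, hV, fun p hp s hs hs1 w c hw hc => ?_⟩
  rw [le_div_iff₀ (by positivity)] at hs1
  refine h p hp (4 * M * s) (by linarith) _ (inBox_pt.2 ⟨hw.trans ?_, hc.trans ?_⟩)
  · gcongr; linarith
  · exact mul_vsize_le m _ hs (by linarith)

lemma exists_localModel_of_mem (m : ℕ) {Ω : Set (ℂ × ℝ)} {p₀ : ℂ × ℝ} (hΩ : Ω ∈ 𝓝 p₀) :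
    ∃ V ∈ 𝓝 p₀, ∃ s₀ M σ F G, LocalModel m Ω V s₀ M σ F G := by
  obtain ⟨s₁, hs₁, V, hV, h⟩ := exists_nhds_pt_mem m hΩ le_rfl
  refine ⟨V, hV, s₁, 1, 0, fun _ => -1, fun _ => 0, hs₁, le_rfl, by simp, ?_, ?_⟩
  · intro p hp s hs hs1 w c hw hc
    simp [h p hp s hs hs1 w c hw hc]
  · intro p hp s hs hs1 w c hw hc
    simp [slack]

/-- At a noncharacteristic boundary point the horizontal gradient of a defining function dominates
the quadratic error of the Taylor expansion. -/
lemma exists_localModel_of_not_isCharacteristic (m : ℕ) {Ω : Set (ℂ × ℝ)} {p₀ : ℂ × ℝ}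
    {F : ℂ × ℝ → ℝ} (hF : IsDefiningFunction Ω p₀ F)
    (hX : ¬(fderiv ℝ F p₀ (X m p₀) = 0 ∧ fderiv ℝ F p₀ (Y m p₀) = 0)) :
    ∃ V ∈ 𝓝 p₀, ∃ s₀ M σ F G, LocalModel m Ω V s₀ M σ F G := by
  obtain ⟨U, hU, hpU, hFU, -, hΩU, -⟩ := hF
  have hUn : U ∈ 𝓝 p₀ := hU.mem_nhds hpU
  have hF' : ContDiffOn ℝ 1 (fderiv ℝ F) U := hFU.fderiv_of_isOpen hU (by decide)
  obtain ⟨K, T, hT, hK⟩ := (hF'.contDiffAt hUn).exists_lipschitzOnWith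
  obtain ⟨ρ, hρ, hball⟩ := Metric.mem_nhds_iff.1 (inter_mem hUn hT)
  -- `ℓ p w` is the derivative of `F` along the horizontal vector with planar part `w`.
  let ℓ : ℂ × ℝ → ℂ →L[ℝ] ℝ := fun p =>
    (fderiv ℝ F p).comp ((ContinuousLinearMap.id ℝ ℂ).prod (lin m p.1))
  let G : ℂ × ℝ → ℂ := fun p => planeGrad (ℓ p)
  have hc : ContinuousAt (fderiv ℝ F) p₀ := (hF'.contDiffAt hUn).continuousAt
  have hℓ : ∀ w : ℂ, ContinuousAt (fun p => ℓ p w) p₀ := fun w => by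
    have : ContinuousAt (fun p : ℂ × ℝ => ((w, lin m p.1 w) : ℂ × ℝ)) p₀ := by
      simp only [lin_apply]; fun_prop
    exact hc.clm_apply this
  have hGc : ContinuousAt (fun p => ‖G p‖) p₀ := by
    have : ContinuousAt G p₀ := by
      have e : G = fun p => ((ℓ p 1 : ℝ) : ℂ) + ((ℓ p Complex.I : ℝ) : ℂ) * Complex.I := by
        funext p
        apply Complex.ext <;> simp [G, planeGrad]
      rw [e]
      exact ((Complex.continuous_ofReal.continuousAt.comp (hℓ 1))).add
        ((Complex.continuous_ofReal.continuousAt.comp (hℓ Complex.I)).mul continuousAt_const)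
    exact this.norm
  have hG0 : 0 < ‖G p₀‖ := by
    rw [norm_pos_iff]
    intro h0
    apply hX
    have h1 : ∀ w, fderiv ℝ F p₀ (w, lin m p₀.1 w) = 0 := fun w => by
      have := inner_planeGrad (ℓ p₀) w
      rw [show planeGrad (ℓ p₀) = 0 from h0, inner_zero_left] at this
      exact this.symm
    have hXe : X m p₀ = ((1 : ℂ), lin m p₀.1 1) := by simp [X, lin_apply]
    have hYe : Y m p₀ = (Complex.I, lin m p₀.1 Complex.I) := by simp [Y, lin_apply]
    rw [hXe, hYe]
    exact ⟨h1 _, h1 _⟩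
  set c₀ : ℝ := ‖G p₀‖ / 2 with hc₀
  have hc₀pos : 0 < c₀ := half_pos hG0
  have e1 : ∀ᶠ p in 𝓝 p₀, c₀ < ‖G p‖ := hGc.eventually_const_lt (half_lt_self hG0)
  set L : ℝ := ‖fderiv ℝ F p₀‖ + 1 with hL
  have e2 : ∀ᶠ p in 𝓝 p₀, ‖fderiv ℝ F p‖ < L :=
    hc.norm.eventually_lt_const (lt_add_one _)
  set R : ℝ := ‖p₀.1‖ + 1 with hR
  have hR0 : 0 ≤ R := by positivity
  have e3 : ∀ᶠ p : ℂ × ℝ in 𝓝 p₀, ‖p.1‖ < R :=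
    (continuous_fst.norm.continuousAt).eventually_lt_const (lt_add_one _)
  obtain ⟨s₁, hs₁, V, hV, hVpt⟩ := exists_nhds_pt_mem m (Metric.ball_mem_nhds p₀ hρ) le_rfl
  set B : ℝ := 4 * (R + 1) ^ (2 * m) with hB
  set A : ℝ := 3 + ((2 * m + 1) * R ^ (2 * m) * R * 3 + B) with hA
  have hB0 : 0 ≤ B := by positivity
  have hA0 : 0 ≤ A := by positivity
  set Q : ℝ := 100 * (L * B + K * A ^ 2) + 1 with hQ
  have hL0 : 0 ≤ L := by positivity
  have hQ0 : 0 < Q := by positivity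
  refine ⟨{p | c₀ < ‖G p‖ ∧ ‖fderiv ℝ F p‖ < L ∧ ‖p.1‖ < R} ∩ V ∩ Metric.ball p₀ ρ,
    inter_mem (inter_mem (e1.and (e2.and e3)) hV) (Metric.ball_mem_nhds p₀ hρ),
    min s₁ (min 1 (c₀ / Q)), 1, 0, F, G, lt_min hs₁ (lt_min one_pos (by positivity)), le_rfl,
    by simp, ?_, ?_⟩
  · rintro p ⟨⟨-, hpV⟩, -⟩ s hs hss w c hw hc
    have hmem := (hball (hVpt p hpV s hs (hss.trans (min_le_left _ _)) w c hw hc)).1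
    have h : pt m p w c ∈ Ω ∩ U ↔ pt m p w c ∈ {q | q ∈ U ∧ F q < 0} := by rw [hΩU]
    simpa [hmem] using h
  · rintro p ⟨⟨⟨hp1, hp2, hp3⟩, hpV⟩, hpB⟩ s hs hss w c hw hc
    have hmem := hVpt p hpV s hs (hss.trans (min_le_left _ _)) w c hw hc
    have hs1 : s ≤ 1 := hss.trans ((min_le_right _ _).trans (min_le_left _ _))
    have hsQ : s * Q ≤ c₀ := by
      have := hss.trans ((min_le_right _ _).trans (min_le_right _ _))
      rwa [le_div_iff₀ hQ0] at this
    have hcB : |c| ≤ B * s ^ 2 := by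
      refine hc.trans ?_
      unfold vsize
      calc _ ≤ 4 * 1 * (s ^ 2 * (R + 1) ^ (2 * m)) := by gcongr
        _ = _ := by rw [hB]; ring
    have hss2 : s ^ 2 ≤ s := by nlinarith
    set v : ℂ × ℝ := pt m p w c - p with hv
    have hve : v = (w, lin m p.1 w) + (0, c) := by
      ext1 <;> simp [hv, pt]; ring
    have hvn : ‖v‖ ≤ A * s := by
      have h1 : |lin m p.1 w| ≤ (2 * m + 1) * R ^ (2 * m) * R * (3 * s) :=
        (abs_lin_le m p.1 w).trans (by gcongr)
      have h2 : |c| ≤ B * s := hcB.trans (by gcongr)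
      have h3 : 0 ≤ (2 * m + 1) * R ^ (2 * m) * R * (3 * s) := by positivity
      have h4 : 0 ≤ B * s := by positivity
      rw [hve, Prod.norm_def]
      simp only [Prod.mk_add_mk, add_zero, Real.norm_eq_abs]
      refine max_le ?_ ((abs_add_le _ _).trans ?_)
      · rw [hA]; linarith
      · rw [hA]; linarith
    have ht := norm_sub_sub_fderiv_le (f := F) hpB hmem K.2
      (fun u hu => ((hFU.contDiffAt (hU.mem_nhds (hball hu).1)).differentiableAt (by simp)))
      (fun u hu _ => by
        have := hK.dist_le_mul u (hball hu).2 p (hball hpB).2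
        rwa [dist_eq_norm, dist_eq_norm] at this)
    rw [← hv, hve, map_add, ← hve] at ht
    have hin : inner ℝ (G p) w = fderiv ℝ F p (w, lin m p.1 w) := inner_planeGrad (ℓ p) w
    have hcF : |fderiv ℝ F p (0, c)| ≤ L * (B * s ^ 2) := by
      refine ((fderiv ℝ F p).le_opNorm _).trans ?_
      have : ‖((0 : ℂ), c)‖ ≤ B * s ^ 2 := by
        rw [Prod.norm_def]
        simpa using hcB
      gcongr
    rw [hin, zero_mul, sub_zero]
    have hK0 : (0 : ℝ) ≤ K := K.2
    calc |F (pt m p w c) - F p - fderiv ℝ F p (w, lin m p.1 w)|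
        = |(F (pt m p w c) - F p - (fderiv ℝ F p (w, lin m p.1 w) + fderiv ℝ F p (0, c))) +
            fderiv ℝ F p (0, c)| := by congr 1; ring
      _ ≤ K * ‖v‖ ^ 2 + L * (B * s ^ 2) := (abs_add_le _ _).trans (add_le_add ht hcF)
      _ ≤ K * (A * s) ^ 2 + L * (B * s ^ 2) := by gcongr
      _ = 1 / 100 * (s * (s * (Q - 1))) := by rw [hQ]; ring
      _ ≤ 1 / 100 * (s * (s * Q)) := by gcongr; linarith
      _ ≤ 1 / 100 * (s * ‖G p‖) := by gcongr; linarith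
      _ = 1 / 100 * slack m 1 0 G p s := by unfold slack; ring

lemma abs_iteratedFDeriv_le_derivMax (k : ℕ) (φ : ℂ → ℝ) (z : ℂ) (j : Fin k → Fin 2) :
    |iteratedFDeriv ℝ k φ z (fun i => ![(1 : ℂ), Complex.I] (j i))| ≤ derivMax k φ z :=
  le_ciSup (f := fun j : Fin k → Fin 2 =>
    |iteratedFDeriv ℝ k φ z (fun i => ![(1 : ℂ), Complex.I] (j i))|) (Set.finite_range _).bddAbove j

lemma norm_fderiv_fderiv_le (φ : ℂ → ℝ) (z : ℂ) :
    ‖fderiv ℝ (fderiv ℝ φ) z‖ ≤ 4 * derivMax 2 φ z := by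
  set T := fderiv ℝ (fderiv ℝ φ) z with hT
  set D := derivMax 2 φ z with hD
  have key : ∀ a b : Fin 2, |T (![(1 : ℂ), Complex.I] a) (![(1 : ℂ), Complex.I] b)| ≤ D :=
    fun a b => by
      have h := abs_iteratedFDeriv_le_derivMax 2 φ z ![a, b]
      rw [iteratedFDeriv_two_apply] at h
      simpa using h
  have h11 := key 0 0
  have h12 := key 0 1
  have h21 := key 1 0
  have h22 := key 1 1
  simp only [Matrix.cons_val_zero, Matrix.cons_val_one] at h11 h12 h21 h22
  have hD0 : 0 ≤ D := (abs_nonneg _).trans h11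
  have aux : ∀ (ℓ : ℂ →L[ℝ] ℝ) (E : ℝ) (w : ℂ), |ℓ 1| ≤ E → |ℓ Complex.I| ≤ E →
      |ℓ w| ≤ 2 * E * ‖w‖ := fun ℓ E w h1 h2 => by
    rw [clm_apply_eq]
    have h3 := Complex.abs_re_le_norm w
    have h4 := Complex.abs_im_le_norm w
    refine (abs_add_le _ _).trans ?_
    rw [abs_mul, abs_mul]
    calc _ ≤ ‖w‖ * E + ‖w‖ * E := by gcongr
      _ = _ := by ring
  refine T.opNorm_le_bound₂ (by positivity) fun u v => ?_
  have hu : ∀ e : ℂ, |T 1 e| ≤ D → |T Complex.I e| ≤ D → |T u e| ≤ 2 * D * ‖u‖ := fun e h1 h2 =>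
    aux (T.flip e) D u h1 h2
  have h := aux (T u) (2 * D * ‖u‖) v (hu 1 h11 h21) (hu Complex.I h12 h22)
  rw [Real.norm_eq_abs]
  linarith

/-- The weighted first order Taylor estimate of an admissible graph. -/
lemma abs_graph_taylor_le {m : ℕ} {A : Set ℂ} {φ : ℂ → ℝ} (hA : IsOpen A)
    (hφ : ContDiffOn ℝ ∞ φ A) {C : ℝ} (hC : 0 ≤ C)
    (hD : ∀ z ∈ A, derivMax 2 φ z ≤ C * ‖z‖ ^ (2 * m)) {z₀ z w : ℂ} {ρ : ℝ}
    (hball : Metric.ball z₀ ρ ⊆ A) (hz : z ∈ Metric.ball z₀ ρ) (hzw : z + w ∈ Metric.ball z₀ ρ) :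
    |φ (z + w) - φ z - fderiv ℝ φ z w| ≤ 4 * C * (‖z‖ + ‖w‖) ^ (2 * m) * ‖w‖ ^ 2 := by
  have hφ' : ContDiffOn ℝ 1 (fderiv ℝ φ) A := hφ.fderiv_of_isOpen hA (by decide)
  have h := norm_sub_sub_fderiv_le (f := φ) (K := 4 * C * (‖z‖ + ‖w‖) ^ (2 * m)) hz hzw
    (by positivity)
    (fun u hu => (hφ.contDiffAt (hA.mem_nhds (hball hu))).differentiableAt (by simp))
    (fun u hu hu' => ?_)
  · simpa using h
  · rw [add_sub_cancel_left] at hu'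
    have hconv : Convex ℝ (Metric.ball z₀ ρ ∩ Metric.closedBall z ‖w‖) :=
      (convex_ball _ _).inter (convex_closedBall _ _)
    refine hconv.norm_image_sub_le_of_norm_fderiv_le (𝕜 := ℝ) (fun v hv => ?_) (fun v hv => ?_)
      ⟨hz, Metric.mem_closedBall_self (norm_nonneg _)⟩ ⟨hu, mem_closedBall_iff_norm.2 hu'⟩
    · exact (hφ'.contDiffAt (hA.mem_nhds (hball hv.1))).differentiableAt (by simp)
    · refine (norm_fderiv_fderiv_le φ v).trans ?_
      have h1 := hD v (hball hv.1)
      have h2 : ‖v‖ ≤ ‖z‖ + ‖w‖ := by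
        have := norm_add_le z (v - z)
        rw [add_sub_cancel] at this
        linarith [mem_closedBall_iff_norm.1 hv.2]
      calc _ ≤ 4 * (C * ‖v‖ ^ (2 * m)) := by gcongr
        _ ≤ 4 * (C * (‖z‖ + ‖w‖) ^ (2 * m)) := by gcongr
        _ = _ := by ring

/-- A nonzero linear form that vanishes on `X` and `Y` does not vanish on `∂_t`. -/
lemma apply_vertical_ne_zero (m : ℕ) {p : ℂ × ℝ} {T : ℂ × ℝ →L[ℝ] ℝ} (hT : T ≠ 0)
    (hX : T (X m p) = 0) (hY : T (Y m p) = 0) : T (0, 1) ≠ 0 := by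
  intro h0
  apply hT
  have hv : ∀ c : ℝ, T (0, c) = 0 := fun c => by
    have : ((0 : ℂ), c) = c • ((0 : ℂ), (1 : ℝ)) := by simp
    rw [this, map_smul, h0, smul_zero]
  refine ContinuousLinearMap.ext fun q => ?_
  have e : q = (q.1.re • X m p + q.1.im • Y m p) + (0, q.2 - lin m p.1 q.1) := by
    rw [smul_X_add_smul_Y]
    ext1 <;> simp
  rw [e, map_add, map_add, map_smul, map_smul, hX, hY, hv]
  simp

/-- At a characteristic boundary point, `Ω` lies locally on one side of the admissible graph. -/
lemma exists_mem_iff_of_isCharacteristic (m : ℕ) {Ω : Set (ℂ × ℝ)} {p₀ : ℂ × ℝ}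
    {F : ℂ × ℝ → ℝ} (hp₀ : p₀ ∈ frontier Ω) (hF : IsDefiningFunction Ω p₀ F)
    (hX : fderiv ℝ F p₀ (X m p₀) = 0) (hY : fderiv ℝ F p₀ (Y m p₀) = 0) {N : Set (ℂ × ℝ)}
    (hN : N ∈ 𝓝 p₀) {A : Set ℂ} {φ : ℂ → ℝ} (hA : IsOpen A) (hφ : ContinuousOn φ A)
    (hgraph : frontier Ω ∩ N = {p | p.1 ∈ A ∧ p.2 = φ p.1}) :
    ∃ σ : ℝ, (σ = 1 ∨ σ = -1) ∧ ∃ ρ > 0, ∃ h > 0, Metric.ball p₀.1 ρ ⊆ A ∧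
      ∀ q ∈ Metric.ball p₀.1 ρ ×ˢ Metric.ball p₀.2 h, (q ∈ Ω ↔ σ * (q.2 - φ q.1) < 0) := by
  obtain ⟨U, hU, hpU, hFU, hne, hΩU, hfU⟩ := hF
  have hUn : U ∈ 𝓝 p₀ := hU.mem_nhds hpU
  have hp₀A : p₀.1 ∈ A ∧ p₀.2 = φ p₀.1 := by
    have : p₀ ∈ frontier Ω ∩ N := ⟨hp₀, mem_of_mem_nhds hN⟩
    rwa [hgraph] at this
  have hD := apply_vertical_ne_zero m (hne p₀ hpU) hX hY
  obtain ⟨σ, hσ, hσD⟩ : ∃ σ : ℝ, (σ = 1 ∨ σ = -1) ∧ 0 < σ * fderiv ℝ F p₀ (0, 1) := by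
    rcases lt_or_gt_of_ne hD with h | h
    · exact ⟨-1, Or.inr rfl, by linarith⟩
    · exact ⟨1, Or.inl rfl, by linarith⟩
  have hF' : ContDiffOn ℝ 1 (fderiv ℝ F) U := hFU.fderiv_of_isOpen hU (by decide)
  have hc : ContinuousAt (fun q => σ * fderiv ℝ F q (0, 1)) p₀ :=
    continuousAt_const.mul ((hF'.contDiffAt hUn).continuousAt.clm_apply continuousAt_const)
  obtain ⟨r, hr, hball⟩ := Metric.mem_nhds_iff.1
    (inter_mem (inter_mem hUn hN) (hc.eventually_const_lt hσD))
  have hsub : ∀ z : ℂ, ∀ t : ℝ, z ∈ Metric.ball p₀.1 r → t ∈ Metric.ball p₀.2 r →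
      (z, t) ∈ (U ∩ N) ∩ {q | 0 < σ * fderiv ℝ F q (0, 1)} := fun z t hz ht => hball (by
    rw [Metric.mem_ball, Prod.dist_eq]; exact max_lt hz ht)
  have hφc : ContinuousAt φ p₀.1 := hφ.continuousAt (hA.mem_nhds hp₀A.1)
  have hev : ∀ᶠ z in 𝓝 p₀.1, z ∈ A ∧ φ z ∈ Metric.ball p₀.2 r ∧ z ∈ Metric.ball p₀.1 r :=
    (hA.mem_nhds hp₀A.1 |> Filter.eventually_mem_set.2).and
      ((hφc.eventually_mem (by rw [← hp₀A.2]; exact Metric.ball_mem_nhds _ hr)).and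
        (Metric.ball_mem_nhds _ hr))
  obtain ⟨ρ, hρ, hρA⟩ := Metric.eventually_nhds_iff_ball.1 hev
  refine ⟨σ, hσ, ρ, hρ, r, hr, fun z hz => (hρA z hz).1, ?_⟩
  rintro ⟨z, t⟩ ⟨hz, ht⟩
  obtain ⟨hzA, hφz, hzr⟩ := hρA z hz
  -- Along the vertical line over `z`, the function `σ F` increases and vanishes at `φ z`.
  have hmono : StrictMonoOn (fun u => σ * F (z, u)) (Metric.ball p₀.2 r) := by
    have hder : ∀ u ∈ Metric.ball p₀.2 r,
        HasDerivAt (fun u => σ * F (z, u)) (σ * fderiv ℝ F (z, u) (0, 1)) u := fun u hu => by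
      have h1 := (hsub z u hzr hu).1.1
      have h2 := ((hFU.contDiffAt (hU.mem_nhds h1)).differentiableAt (by simp)).hasFDerivAt
      have h3 : HasDerivAt (fun u : ℝ => (z, u)) ((0 : ℂ), (1 : ℝ)) u :=
        (hasDerivAt_const u z).prodMk (hasDerivAt_id u)
      exact (h2.comp_hasDerivAt u h3).const_mul σ
    refine strictMonoOn_of_deriv_pos (convex_ball _ _)
      (fun u hu => (hder u hu).continuousAt.continuousWithinAt) fun u hu => ?_
    have hu' := interior_subset hu
    rw [(hder u hu').deriv]
    exact (hsub z u hzr hu').2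
  have hzero : F (z, φ z) = 0 := by
    have h1 : (z, φ z) ∈ frontier Ω ∩ N := by rw [hgraph]; exact ⟨hzA, rfl⟩
    have h2 : (z, φ z) ∈ frontier Ω ∩ U := ⟨h1.1, (hsub z _ hzr hφz).1.1⟩
    rw [hfU] at h2
    exact h2.2
  have hΩ : (z, t) ∈ Ω ↔ F (z, t) < 0 := by
    have hmem := (hsub z t hzr ht).1.1
    have h : (z, t) ∈ Ω ∩ U ↔ (z, t) ∈ {q | q ∈ U ∧ F q < 0} := by rw [hΩU]
    simpa [hmem] using h
  rw [hΩ]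
  have hlt := hmono.lt_iff_lt ht hφz
  have hlt' := hmono.lt_iff_lt hφz ht
  simp only [hzero, mul_zero] at hlt hlt'
  rcases hσ with rfl | rfl
  · rw [one_mul] at hlt ⊢
    rw [hlt, sub_neg]
  · constructor
    · intro h
      have := hlt'.1 (by linarith)
      linarith
    · intro h
      have := hlt'.2 (by linarith)
      linarith

/-- At a characteristic boundary point, admissibility makes the error of the expansion of
`σ (t - φ(z))` comparable with the vertical size of boxes. -/
lemma exists_localModel_of_isCharacteristic (m : ℕ) {Ω : Set (ℂ × ℝ)} {p₀ : ℂ × ℝ}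
    (hp : IsCharacteristic m Ω p₀) {N : Set (ℂ × ℝ)} (hN : N ∈ 𝓝 p₀)
    (hadm : IsAdmissibleGraph m (frontier Ω ∩ N)) :
    ∃ V ∈ 𝓝 p₀, ∃ s₀ M σ F G, LocalModel m Ω V s₀ M σ F G := by
  obtain ⟨hp₀, F, hF, hX, hY⟩ := hp
  obtain ⟨A, φ, hA, hφ, hgraph, C, hC, hder⟩ := hadm
  obtain ⟨σ, hσ, ρ, hρ, h, hh, hρA, hiff⟩ := exists_mem_iff_of_isCharacteristic m hp₀ hF hX hY hN
    hA hφ.continuousOn hgraph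
  have hσ1 : |σ| = 1 := by rcases hσ with rfl | rfl <;> simp
  have hσ2 : σ ^ 2 = 1 := by rw [← sq_abs, hσ1, one_pow]
  set B : ℝ := 4 * C * 3 ^ (2 * m) * 9 with hB
  set M : ℝ := 1 + 100 * B with hM
  have hB0 : 0 ≤ B := by positivity
  have hM1 : 1 ≤ M := by linarith
  have hW : Metric.ball p₀.1 ρ ×ˢ Metric.ball p₀.2 h ∈ 𝓝 p₀ :=
    prod_mem_nhds (Metric.ball_mem_nhds _ hρ) (Metric.ball_mem_nhds _ hh)
  obtain ⟨s₁, hs₁, V, hV, hVpt⟩ := exists_nhds_pt_mem m hW hM1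
  refine ⟨V, hV, s₁, M, σ, fun q => σ * (q.2 - φ q.1),
    fun p => planeGrad (σ • (lin m p.1 - fderiv ℝ φ p.1)), hs₁, hM1, by rw [hσ1, hσ2], ?_, ?_⟩
  · exact fun p hp s hs hs1 w c hw hc => hiff _ (hVpt p hp s hs hs1 w c hw hc)
  · intro p hp s hs hs1 w c hw hc
    have h1 := (hVpt p hp s hs hs1 w c hw hc).1
    have h0 : p.1 ∈ Metric.ball p₀.1 ρ := by
      have := (hVpt p hp 0 le_rfl hs₁.le 0 0 (by simp) (by simp [vsize_zero])).1
      rwa [pt_zero] at this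
    have ht := abs_graph_taylor_le hA hφ hC.le (fun z hz => (hder z hz).2.1) hρA h0 h1
    have hv0 := vsize_nonneg m p.1 s
    rw [inner_planeGrad]
    have e : σ * ((pt m p w c).2 - φ (pt m p w c).1) - σ * (p.2 - φ p.1) -
        (σ • (lin m p.1 - fderiv ℝ φ p.1)) w - σ * c =
        -(σ * (φ (p.1 + w) - φ p.1 - fderiv ℝ φ p.1 w)) := by
      simp only [pt, _root_.smul_apply, _root_.sub_apply, smul_eq_mul]
      ring
    rw [e, abs_neg, abs_mul, hσ1, one_mul]
    have h3 : (‖p.1‖ + ‖w‖) ^ (2 * m) ≤ 3 ^ (2 * m) * (‖p.1‖ + s) ^ (2 * m) := by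
      rw [← mul_pow]
      have := norm_nonneg p.1
      gcongr
      linarith
    calc _ ≤ 4 * C * (‖p.1‖ + ‖w‖) ^ (2 * m) * ‖w‖ ^ 2 := ht
      _ ≤ 4 * C * (3 ^ (2 * m) * (‖p.1‖ + s) ^ (2 * m)) * (3 * s) ^ 2 := by gcongr
      _ = B * vsize m p.1 s := by rw [hB]; unfold vsize; ring
      _ ≤ 1 / 100 * (M * vsize m p.1 s) := by rw [hM]; linarith
      _ ≤ _ := by
        unfold slack
        rw [hσ2, one_mul]
        gcongr
        have : 0 ≤ s * ‖planeGrad (σ • (lin m p.1 - fderiv ℝ φ p.1))‖ := by positivity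
        linarith

/-- Every point of the closure of an admissible domain is the center of a local model. -/
lemma IsAdmissibleDomain.exists_localModel {m : ℕ} {Ω : Set (ℂ × ℝ)}
    (hΩ : IsAdmissibleDomain m Ω) {p₀ : ℂ × ℝ} (hp₀ : p₀ ∈ closure Ω) :
    ∃ V ∈ 𝓝 p₀, ∃ s₀ M σ F G, LocalModel m Ω V s₀ M σ F G := by
  by_cases hmem : p₀ ∈ Ω
  · exact exists_localModel_of_mem m (hΩ.isOpen.mem_nhds hmem)
  have hfr : p₀ ∈ frontier Ω := by
    rw [hΩ.isOpen.frontier_eq]; exact ⟨hp₀, hmem⟩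
  by_cases hchar : IsCharacteristic m Ω p₀
  · obtain ⟨N, hN, hadm⟩ := hΩ.admissible p₀ hchar
    exact exists_localModel_of_isCharacteristic m hchar hN hadm
  · obtain ⟨F, hF⟩ := hΩ.smoothBoundary p₀ hfr
    exact exists_localModel_of_not_isCharacteristic m hF fun h => hchar ⟨hfr, F, hF, h.1, h.2⟩

/-! ### From local to global -/

lemma JohnArc.mono {m : ℕ} {Ω : Set (ℂ × ℝ)} {ε ε' D D' : ℝ} {p x : ℂ × ℝ}
    (h : JohnArc m Ω ε D p x) (hε : ε' ≤ ε) (hD : D ≤ D') : JohnArc m Ω ε' D' p x := by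
  obtain ⟨γ, hγ, hγD, hγε⟩ := h
  refine ⟨γ, hγ, hγD.trans (ENNReal.ofReal_le_ofReal hD), fun t ht =>
    (ccBall_mono ?_).trans (hγε t ht)⟩
  gcongr

lemma UniformArc.mono {m : ℕ} {Ω : Set (ℂ × ℝ)} {ε ε' D D' : ℝ} {p q : ℂ × ℝ}
    (h : UniformArc m Ω ε D p q) (hε : ε' ≤ ε) (hD : D ≤ D') : UniformArc m Ω ε' D' p q := by
  obtain ⟨γ, hγ, hγD, hγε⟩ := h
  refine ⟨γ, hγ, hγD.trans (ENNReal.ofReal_le_ofReal hD), fun t ht =>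
    (ccBall_mono ?_).trans (hγε t ht)⟩
  gcongr

/-- In a connected open set, a curve between two given points stays at a positive distance from
the complement. -/
lemma exists_isCurveIn_ccBall_subset (m : ℕ) {Ω : Set (ℂ × ℝ)} (hΩ : IsOpen Ω)
    (hc : IsConnected Ω) {x y : ℂ × ℝ} (hx : x ∈ Ω) (hy : y ∈ Ω) :
    ∃ σ, IsCurveIn Ω σ x y ∧ ∃ η > 0, ∀ t ∈ Icc (0 : ℝ) 1,
      ccBall m (σ t) (ENNReal.ofReal η) ⊆ Ω := by
  have hj := (hΩ.isConnected_iff_isPathConnected.1 hc).joinedIn x hx y hy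
  let σ := hj.somePath.extend
  have hσ : Continuous σ := hj.somePath.continuous_extend
  have hmem : ∀ t ∈ Icc (0 : ℝ) 1, σ t ∈ Ω := fun t ht => by
    rw [Path.extend_apply _ ht]
    exact hj.somePath_mem _
  obtain ⟨η, hη, h⟩ := exists_ccBall_subset_of_isCompact m (isCompact_Icc.image hσ) hΩ
    (image_subset_iff.2 hmem)
  exact ⟨σ, ⟨hσ.continuousOn, hmem, by simp [σ], by simp [σ]⟩, η, hη, fun t ht =>
    h _ (mem_image_of_mem σ ht)⟩

lemma IsAdmissibleDomain.isCompact_closure {m : ℕ} {Ω : Set (ℂ × ℝ)}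
    (hΩ : IsAdmissibleDomain m Ω) : IsCompact (closure Ω) := hΩ.isBounded.isCompact_closure

/-- All points of an admissible domain are joined to a given one by John arcs with uniform
constants. -/
lemma IsAdmissibleDomain.exists_johnArc {m : ℕ} {Ω : Set (ℂ × ℝ)} (hΩ : IsAdmissibleDomain m Ω)
    {x : ℂ × ℝ} (hx : x ∈ Ω) : ∃ ε > 0, ∃ D > 0, ∀ p ∈ Ω, JohnArc m Ω ε D p x := by
  obtain ⟨D₀, hD₀, hdiam⟩ := exists_ccDist_le_of_isBounded m hΩ.isBounded
  suffices h : ∃ ε > 0, ∃ D > 0, ∀ p ∈ closure Ω, p ∈ Ω → JohnArc m Ω ε D p x by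
    obtain ⟨ε, hε, D, hD, h⟩ := h
    exact ⟨ε, hε, D, hD, fun p hp => h p (subset_closure hp) hp⟩
  refine hΩ.isCompact_closure.induction_on
    (p := fun S => ∃ ε > 0, ∃ D > 0, ∀ p ∈ S, p ∈ Ω → JohnArc m Ω ε D p x)
    ⟨1, one_pos, 1, one_pos, by simp⟩ ?_ ?_ ?_
  · rintro S T hST ⟨ε, hε, D, hD, h⟩
    exact ⟨ε, hε, D, hD, fun p hp => h p (hST hp)⟩
  · rintro S T ⟨ε, hε, D, hD, h⟩ ⟨ε', hε', D', hD', h'⟩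
    refine ⟨min ε ε', lt_min hε hε', max D D', lt_max_of_lt_left hD, ?_⟩
    rintro p (hp | hp) hpΩ
    · exact (h p hp hpΩ).mono (min_le_left _ _) (le_max_left _ _)
    · exact (h' p hp hpΩ).mono (min_le_right _ _) (le_max_right _ _)
  · intro p₀ hp₀
    obtain ⟨V, hV, s₀, M, σ, F, G, H⟩ := hΩ.exists_localModel hp₀
    obtain ⟨W, hW, ε, hε, K, hK, hloc⟩ := H.exists_nhds_uniformArc hV
    obtain ⟨y, hyW, hyΩ⟩ := mem_closure_iff_nhds.1 hp₀ W hW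
    obtain ⟨η, hη, hηy⟩ := exists_forall_ccDist_lt_ccBall_subset m (hΩ.isOpen.mem_nhds hyΩ)
    obtain ⟨τ, hτ, η', hη', hτη⟩ := exists_isCurveIn_ccBall_subset m hΩ.isOpen hΩ.isConnected hyΩ hx
    have hKD : 0 < K * D₀ := by positivity
    set ε₁ : ℝ := min ε (min (η / (K * D₀)) (ε * η / (K * D₀))) with hε₁
    have hε₁pos : 0 < ε₁ := lt_min hε (lt_min (by positivity) (by positivity))
    set ε₂ : ℝ := min ε₁ (η' / (K * D₀ + D₀)) with hε₂
    have hε₂pos : 0 < ε₂ := lt_min hε₁pos (by positivity)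
    refine ⟨W, mem_nhdsWithin_of_mem_nhds hW, ε₂, hε₂pos, K * D₀ + D₀, by positivity,
      fun p hpW hpΩ => ?_⟩
    have hd : (ccDist m p y).toReal ≤ D₀ :=
      ENNReal.toReal_le_of_le_ofReal hD₀.le (hdiam p hpΩ y hyΩ)
    have h1 := (hloc p ⟨hpW, hpΩ⟩ y ⟨hyW, hyΩ⟩).mono le_rfl (mul_le_mul_of_nonneg_left hd hK.le)
    have h2 : JohnArc m Ω ε₁ (K * D₀) p y := h1.johnArc hηy hε₁pos.le (min_le_left _ _)
      ((le_div_iff₀ hKD).1 ((min_le_right _ _).trans (min_le_left _ _)))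
      ((le_div_iff₀ hKD).1 ((min_le_right _ _).trans (min_le_right _ _)))
    refine h2.trans_curve hτ (D' := D₀) (curveDiam_le fun s hs s' hs' =>
      hdiam _ (hτ.mapsTo hs) _ (hτ.mapsTo hs')) hτη hKD.le hD₀.le hε₂pos.le (min_le_left _ _) ?_
    exact (le_div_iff₀ (by positivity)).1 (min_le_right _ _)

/-- Any two points of an admissible domain are joined by a uniform arc, with uniform constants:
close points by the local construction, distant points through a fixed center. -/
lemma IsAdmissibleDomain.exists_uniformArc {m : ℕ} {Ω : Set (ℂ × ℝ)}
    (hΩ : IsAdmissibleDomain m Ω) : ∃ ε > 0, ∃ K > 0, ∀ p ∈ Ω, ∀ q ∈ Ω,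
      UniformArc m Ω ε (K * (ccDist m p q).toReal) p q := by
  obtain ⟨x, hx⟩ := hΩ.isConnected.nonempty
  obtain ⟨ε₀, hε₀, D, hD, hJ⟩ := hΩ.exists_johnArc hx
  suffices h : ∃ ε > 0, ∃ K > 0, ∀ a ∈ closure Ω ×ˢ closure Ω, a.1 ∈ Ω → a.2 ∈ Ω →
      UniformArc m Ω ε (K * (ccDist m a.1 a.2).toReal) a.1 a.2 by
    obtain ⟨ε, hε, K, hK, h⟩ := h
    exact ⟨ε, hε, K, hK, fun p hp q hq => h (p, q) ⟨subset_closure hp, subset_closure hq⟩ hp hq⟩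
  refine (hΩ.isCompact_closure.prod hΩ.isCompact_closure).induction_on
    (p := fun S => ∃ ε > 0, ∃ K > 0, ∀ a ∈ S, a.1 ∈ Ω → a.2 ∈ Ω →
      UniformArc m Ω ε (K * (ccDist m a.1 a.2).toReal) a.1 a.2)
    ⟨1, one_pos, 1, one_pos, by simp⟩ ?_ ?_ ?_
  · rintro S T hST ⟨ε, hε, K, hK, h⟩
    exact ⟨ε, hε, K, hK, fun p hp => h p (hST hp)⟩
  · rintro S T ⟨ε, hε, K, hK, h⟩ ⟨ε', hε', K', hK', h'⟩
    refine ⟨min ε ε', lt_min hε hε', max K K', lt_max_of_lt_left hK, ?_⟩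
    rintro a (ha | ha) h1 h2
    · exact (h a ha h1 h2).mono (min_le_left _ _)
        (mul_le_mul_of_nonneg_right (le_max_left _ _) ENNReal.toReal_nonneg)
    · exact (h' a ha h1 h2).mono (min_le_right _ _)
        (mul_le_mul_of_nonneg_right (le_max_right _ _) ENNReal.toReal_nonneg)
  · rintro ⟨p₀, q₀⟩ ⟨hp₀, hq₀⟩
    by_cases heq : p₀ = q₀
    · subst heq
      obtain ⟨V, hV, s₀, M, σ, F, G, H⟩ := hΩ.exists_localModel hp₀
      obtain ⟨W, hW, ε, hε, K, hK, hloc⟩ := H.exists_nhds_uniformArc hV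
      exact ⟨W ×ˢ W, mem_nhdsWithin_of_mem_nhds (prod_mem_nhds hW hW), ε, hε, K, hK,
        fun a ha h1 h2 => hloc _ ⟨ha.1, h1⟩ _ ⟨ha.2, h2⟩⟩
    · obtain ⟨V₁, V₂, hV₁, hV₂, hp, hq, hdisj⟩ := t2_separation heq
      obtain ⟨η, hη, V, hV, hball⟩ := exists_nhds_ccBall_subset m (hV₁.mem_nhds hp)
      refine ⟨V ×ˢ V₂, mem_nhdsWithin_of_mem_nhds (prod_mem_nhds hV (hV₂.mem_nhds hq)), ε₀, hε₀,
        2 * D / η, by positivity, fun a ha h1 h2 => ?_⟩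
      refine (JohnArc.uniformArc hD.le (hJ _ h1) (hJ _ h2)).mono le_rfl ?_
      have hfar : ENNReal.ofReal η ≤ ccDist m a.1 a.2 := by
        by_contra! hlt
        exact Set.disjoint_left.1 hdisj (hball a.1 ha.1 hlt) ha.2
      have hfar' : η ≤ (ccDist m a.1 a.2).toReal :=
        (ENNReal.ofReal_le_iff_le_toReal (ccDist_ne_top m _ _)).1 hfar
      calc 2 * D = 2 * D / η * η := by field_simp
        _ ≤ _ := by gcongr

end Siegel

theorem theorem1p1 (m : ℕ) (hm : 1 ≤ m) (Ω : Set (ℂ × ℝ))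
    (hΩ : Siegel.IsAdmissibleDomain m Ω) :
    Siegel.IsUniformDomain m Ω ∧ Siegel.IsJohnDomain m Ω := by
  constructor
  · obtain ⟨ε, hε, K, hK, h⟩ := hΩ.exists_uniformArc
    refine ⟨hΩ.isOpen, ε, K⁻¹, hε, inv_pos.2 hK, fun p hp q hq => ?_⟩
    obtain ⟨γ, hγ, hγD, hγε⟩ := h p hp q hq
    refine ⟨γ, hγ, hγD.trans (le_of_eq ?_), hγε⟩
    rw [inv_inv, ENNReal.ofReal_mul hK.le, ENNReal.ofReal_toReal (Siegel.ccDist_ne_top m p q)]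
  · obtain ⟨x, hx⟩ := hΩ.isConnected.nonempty
    obtain ⟨ε, hε, D, -, h⟩ := hΩ.exists_johnArc hx
    refine ⟨hΩ.isOpen, hΩ.isBounded, ε, hε, x, hx, fun p hp => ?_⟩
    obtain ⟨γ, hγ, -, hγε⟩ := h p hp
    exact ⟨γ, hγ, fun t ht => hγε t ⟨ht.1.le, ht.2.le⟩⟩
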